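/- Let $n\in\mathbb N$, let $1\le p<n$ be real (so $n\ge 2$), and let $p^*=\frac{np}{n-p}$. Let $\mathbb T^n=\mathbb R^n/\mathbb Z^n$ with Lebesgue measure $dx$ of total mass one. Let $(u_k)_{k\in\mathbb N}$ be a bounded sequence of real-valued functions in $W^{1,p}(\mathbb T^n)$, with weak gradients $Du_k$, and suppose that $$|u_k|^{p^*}\,dx \overset{*}{\rightharpoonup} g\,dx+\mu^s$$ weakly-$*$ as measures on $\mathbb T^n$ (that is, tested against all continuous functions), where $0\le g\in L^1(\mathbb T^n)$ and $\mu^s$ is a finite positive Borel measure singular with respect to Lebesgue measure. Let $v\in\mathbb R^n$ with $|v|=1$, and suppose that for some subsequence $(k_j)_j$ the measures $|(Du_{k_j},v)|^p\,dx$ converge weakly-$*$ to a finite positive Borel measure $\gamma$ that is diffuse, i.e. $\gamma(\{x\})=0$ for every $x\in\mathbb T^n$. Then: 1. $\mu^s=0$; 2. if, moreover, $u_k\rightharpoonup u$ weakly in $L^{p^*}(\mathbb T^n)$ and $u_k\to u$ strongly in $L^1(\mathbb T^n)$ for some $u\in L^{p^*}(\mathbb T^n)$, then $u_k\to u$ strongly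 in $L^{p^*}(\mathbb T^n)$. -/

import Mathlib

open MeasureTheory Filter Topology
open scoped ENNReal NNReal ContDiff

noncomputable section

/-- The flat torus `ℝⁿ / ℤⁿ`; its `volume` is Lebesgue measure, of total mass one. -/
abbrev Torus (n : ℕ) : Type := UnitAddTorus (Fin n)

/-- The quotient map `ℝⁿ → ℝⁿ / ℤⁿ`. -/
def Torus.mk {n : ℕ} (x : EuclideanSpace ℝ (Fin n)) : Torus n := fun i => (x i : UnitAddCircle)

/-- `φ` is smooth on the torus, i.e. its periodic lift to `ℝⁿ` is smooth. -/
def Torus.IsSmooth {n : ℕ} (φ : Torus n → ℝ) : Prop :=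
  ContDiff ℝ ∞ (fun x : EuclideanSpace ℝ (Fin n) => φ (Torus.mk x))

/-- The classical `i`-th partial derivative of a function on the torus. -/
def Torus.partialDeriv {n : ℕ} (i : Fin n) (φ : Torus n → ℝ) (t : Torus n) : ℝ :=
  deriv (fun s : ℝ => φ (t + Torus.mk (EuclideanSpace.single i s))) 0

/-- `G` is the weak (distributional) gradient of `u` on the torus. It is meant for integrable
`u` and `G`. -/
def Torus.IsWeakGradient {n : ℕ} (u : Torus n → ℝ) (G : Torus n → EuclideanSpace ℝ (Fin n)) :
    Prop :=
  ∀ φ : Torus n → ℝ, Torus.IsSmooth φ → ∀ i : Fin n,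
    ∫ x, u x * Torus.partialDeriv i φ x = -∫ x, G x i * φ x

/-- `u` belongs to `W^{1,p}` of the torus and `G` is (a representative of) its gradient `Du`. -/
structure Torus.MemSobolev {n : ℕ} (p : ℝ≥0∞) (u : Torus n → ℝ)
    (G : Torus n → EuclideanSpace ℝ (Fin n)) : Prop where
  memLp : MemLp u p volume
  memLp_grad : MemLp G p volume
  isWeakGradient : Torus.IsWeakGradient u G

/-- The `W^{1,p}` norm `‖u‖_{L^p} + ‖Du‖_{L^p}`, where `G = Du`. -/
def Torus.sobolevNorm {n : ℕ} (p : ℝ≥0∞) (u : Torus n → ℝ)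
    (G : Torus n → EuclideanSpace ℝ (Fin n)) : ℝ≥0∞ :=
  eLpNorm u p volume + eLpNorm G p volume

/-- The Sobolev exponent `p^* = n p / (n - p)`, for `p < n`. -/
def sobolevExponent (n : ℕ) (p : ℝ) : ℝ := n * p / (n - p)

/-- The measure `f dx` on the torus, for a nonnegative function `f`. -/
def Torus.density {n : ℕ} (f : Torus n → ℝ) : Measure (Torus n) :=
  volume.withDensity (fun x => ENNReal.ofReal (f x))

/-- Weak-star convergence of positive finite measures on the torus: convergence of the integrals
of all continuous functions. -/
def Torus.WeakStarTendsto {n : ℕ} (ν : ℕ → Measure (Torus n)) (μ : Measure (Torus n)) : Prop :=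
  ∀ φ : C(Torus n, ℝ), Tendsto (fun k => ∫ x, φ x ∂(ν k)) atTop (𝓝 (∫ x, φ x ∂μ))

/-- A measure is diffuse if it does not charge points. -/
def Torus.IsDiffuse {n : ℕ} (γ : Measure (Torus n)) : Prop := ∀ x : Torus n, γ {x} = 0

/-- Strong convergence in `L^r` of the torus. -/
structure Torus.StrongLpTendsto {n : ℕ} (r : ℝ≥0∞) (w : ℕ → Torus n → ℝ) (u : Torus n → ℝ) :
    Prop where
  memLp : ∀ k, MemLp (w k) r volume
  memLp_limit : MemLp u r volume
  tendsto : Tendsto (fun k => eLpNorm (w k - u) r volume) atTop (𝓝 0)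

/-- Weak convergence in `L^r` of the torus for `1 ≤ r < ∞`, tested against `L^{r'}` with
`1/r + 1/r' = 1`. -/
structure Torus.WeakLpTendsto {n : ℕ} (r : ℝ≥0∞) (w : ℕ → Torus n → ℝ) (u : Torus n → ℝ) :
    Prop where
  memLp : ∀ k, MemLp (w k) r volume
  memLp_limit : MemLp u r volume
  tendsto : ∀ r' : ℝ≥0∞, r.HolderConjugate r' → ∀ ψ : Torus n → ℝ, MemLp ψ r' volume →
    Tendsto (fun k => ∫ x, w k x * ψ x) atTop (𝓝 (∫ x, u x * ψ x))

end

/-!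
The key is an anisotropic Sobolev inequality. Let `v` be a unit vector and `1/q = 1/p - 1/n`.
Applying the Gagliardo–Nirenberg–Sobolev inequality after a dilation by a large factor in the
direction `v` puts a large weight on `∂_v w` and a small one on the rest of the gradient: for every
`η > 0` there is `C` with `‖w‖_q ≤ η ‖Dw‖_p + C (‖∂_v w‖_p + ‖w‖_p)`. Hence `∂_v` alone decides
whether mass concentrates. Localize the inequality to balls of radius `r`, raise it to the power
`q`, and integrate over the centres. Since `q > p`, the local terms in `∂_v w` come with the factor
`(sup_y ‖∂_v w‖_{L^p(B(y, 2r))})^(q - p)`, which is small as soon as `∂_v w` does not charge small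
balls. The upshot: a sequence bounded in `W^{1,p}`, tending to zero in `L^p`, whose derivatives
along `v` do not concentrate at points, tends to zero in `L^q`.

A diffuse weak-star limit of `|∂_v u_k|^p dx` is exactly this nonconcentration, by compactness of
the torus. Applied to the differences of an `L^p`-convergent subsequence, which exists by
Rellich–Kondrachov, it shows that the subsequence is Cauchy in `L^q`. With limit `U`, the weak-star
limit of `|u_k|^q dx` is `|U|^q dx`, so it has no singular part. Testing with the constant `1` gives
convergence of the norms `‖u_k‖_q` along the full sequence, and together with convergence in measure
this is strong convergence.
-/

noncomputable section

section Lebesgue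

theorem exists_pos_mul_rpow_le {A δ : ℝ≥0∞} (hA : A ≠ ⊤) (hδ : 0 < δ) {s : ℝ} (hs : 0 < s) :
    ∃ x : ℝ≥0, 0 < x ∧ A * (x : ℝ≥0∞) ^ s ≤ δ := by
  have hlim : Tendsto (fun x : ℝ≥0 => A * (x : ℝ≥0∞) ^ s) (𝓝[>] 0) (𝓝 0) := by
    have hpow : Tendsto (fun x : ℝ≥0 => (x : ℝ≥0∞) ^ s) (𝓝[>] 0) (𝓝 0) :=
      ((ENNReal.continuous_rpow_const.comp ENNReal.continuous_coe).tendsto' 0 0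
        (by simp [hs])).mono_left nhdsWithin_le_nhds
    simpa using ENNReal.Tendsto.const_mul hpow (Or.inr hA)
  obtain ⟨x, hxδ, hx⟩ := ((hlim.eventually_le_const hδ).and self_mem_nhdsWithin).exists
  exact ⟨x, hx, hxδ⟩

theorem add_add_rpow_le_mul {s : ℝ} (hs : 1 ≤ s) (a b c : ℝ≥0∞) :
    (a + b + c) ^ s ≤ 3 ^ (s - 1) * (a ^ s + b ^ s + c ^ s) := by
  simpa [Fin.sum_univ_three] using
    ENNReal.rpow_sum_le_const_mul_sum_rpow Finset.univ ![a, b, c] hs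

theorem rpow_le_rpow_sub_mul_rpow {x b : ℝ≥0∞} (hxb : x ≤ b) {s t : ℝ} (ht : 0 ≤ t)
    (hts : t ≤ s) : x ^ s ≤ b ^ (s - t) * x ^ t := by
  have hst : 0 ≤ s - t := sub_nonneg.2 hts
  calc x ^ s = x ^ (s - t) * x ^ t := by
        rw [← ENNReal.rpow_add_of_nonneg _ _ hst ht, sub_add_cancel]
    _ ≤ b ^ (s - t) * x ^ t := by gcongr

theorem rpow_le_of_le_mul_add_mul_add {L X Y Z M a η C E : ℝ≥0∞} (hL : L ≤ η * X + C * Y + E * Z)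
    (hYX : Y ≤ X) (hXM : X ≤ M) (hYa : Y ≤ a) {s t : ℝ} (hs : 1 ≤ s) (ht : 0 ≤ t) (hts : t ≤ s) :
    L ^ s ≤ 3 ^ (s - 1) *
      ((M ^ (s - t) * η ^ s + C ^ s * a ^ (s - t)) * X ^ t + E ^ s * Z ^ s) := by
  have hs0 : 0 ≤ s := ht.trans hts
  have hY : Y ^ s ≤ a ^ (s - t) * X ^ t :=
    (rpow_le_rpow_sub_mul_rpow hYa ht hts).trans (by gcongr)
  calc L ^ s ≤ (η * X + C * Y + E * Z) ^ s := by gcongr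
    _ ≤ 3 ^ (s - 1) * (η ^ s * X ^ s + C ^ s * Y ^ s + E ^ s * Z ^ s) := by
        simpa only [ENNReal.mul_rpow_of_nonneg _ _ hs0] using
          add_add_rpow_le_mul hs (η * X) (C * Y) (E * Z)
    _ ≤ 3 ^ (s - 1) * (η ^ s * (M ^ (s - t) * X ^ t) + C ^ s * (a ^ (s - t) * X ^ t) +
        E ^ s * Z ^ s) := by
        gcongr
        exact rpow_le_rpow_sub_mul_rpow hXM ht hts
    _ = _ := by ring

variable {α β ι F : Type*} [MeasurableSpace α] [MeasurableSpace β] [NormedAddCommGroup F]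
  {μ : Measure α} {l : Filter ι}

theorem eLpNorm_integral_le [NormedSpace ℝ F] [SFinite μ] {P : Measure β} [IsProbabilityMeasure P]
    {f : α → β → F} (hf : AEStronglyMeasurable (Function.uncurry f) (μ.prod P)) {p : ℝ≥0}
    (hp : 1 ≤ p) {A : ℝ≥0∞} (hA : ∀ᵐ z ∂P, eLpNorm (fun x => f x z) p μ ≤ A) :
    eLpNorm (fun x => ∫ z, f x z ∂P) p μ ≤ A := by
  have hp0 : p ≠ 0 := (zero_lt_one.trans_le hp).ne'
  have jensen : ∀ᵐ x ∂μ, ‖∫ z, f x z ∂P‖ₑ ^ (p : ℝ) ≤ ∫⁻ z, ‖f x z‖ₑ ^ (p : ℝ) ∂P := by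
    filter_upwards [hf.prodMk_left] with x hx
    rw [← eLpNorm_nnreal_pow_eq_lintegral hp0]
    gcongr
    calc ‖∫ z, f x z ∂P‖ₑ ≤ eLpNorm (f x) 1 P :=
          (enorm_integral_le_lintegral_enorm _).trans_eq eLpNorm_one_eq_lintegral_enorm.symm
      _ ≤ eLpNorm (f x) p P := eLpNorm_le_eLpNorm_of_exponent_le (by exact_mod_cast hp) hx
  rw [← ENNReal.rpow_le_rpow_iff (z := p) (by positivity), eLpNorm_nnreal_pow_eq_lintegral hp0]
  calc ∫⁻ x, ‖∫ z, f x z ∂P‖ₑ ^ (p : ℝ) ∂μ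
      ≤ ∫⁻ x, ∫⁻ z, ‖f x z‖ₑ ^ (p : ℝ) ∂P ∂μ := lintegral_mono_ae jensen
    _ = ∫⁻ z, eLpNorm (fun x => f x z) p μ ^ (p : ℝ) ∂P := by
        simp_rw [eLpNorm_nnreal_pow_eq_lintegral hp0]
        exact lintegral_lintegral_swap (hf.enorm.pow_const _)
    _ ≤ ∫⁻ _, A ^ (p : ℝ) ∂P := lintegral_mono_ae (hA.mono fun z hz => by gcongr)
    _ = A ^ (p : ℝ) := by simp

theorem tendsto_eLpNorm_of_tendsto_eLpNorm_sub {q : ℝ≥0∞} (hq : 1 ≤ q) {u : ι → α → F}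
    {w : α → F} (hu : ∀ i, AEStronglyMeasurable (u i) μ) (hw : MemLp w q μ)
    (h : Tendsto (fun i => eLpNorm (u i - w) q μ) l (𝓝 0)) :
    Tendsto (fun i => eLpNorm (u i) q μ) l (𝓝 (eLpNorm w q μ)) := by
  have hw' := hw.aestronglyMeasurable
  refine tendsto_of_tendsto_of_tendsto_of_le_of_le
    (g := fun i => eLpNorm w q μ - eLpNorm (u i - w) q μ)
    (h := fun i => eLpNorm (u i - w) q μ + eLpNorm w q μ) ?_ ?_ (fun i => ?_) (fun i => ?_)
  · simpa using ENNReal.Tendsto.sub tendsto_const_nhds h (Or.inl hw.eLpNorm_ne_top)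
  · simpa using h.add_const (eLpNorm w q μ)
  · simpa [eLpNorm_sub_comm w] using eLpNorm_add_le (hu i) (hw'.sub (hu i)) hq
  · simpa using eLpNorm_add_le ((hu i).sub hw') hw' hq

/-- Pratt's lemma; the proof rests on `e ≤ min e B + (b - B)` for `e ≤ b`. -/
theorem tendsto_lintegral_zero_of_le_of_tendsto [l.IsCountablyGenerated] {e b : ι → α → ℝ≥0∞}
    {B : α → ℝ≥0∞} (he : ∀ i, AEMeasurable (e i) μ) (hb : ∀ i, AEMeasurable (b i) μ)
    (hB : AEMeasurable B μ) (hle : ∀ i x, e i x ≤ b i x)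
    (he_lim : ∀ᵐ x ∂μ, Tendsto (fun i => e i x) l (𝓝 0))
    (hb_lim : ∀ᵐ x ∂μ, Tendsto (fun i => b i x) l (𝓝 (B x))) (hB_fin : ∫⁻ x, B x ∂μ ≠ ⊤)
    (hb_int : Tendsto (fun i => ∫⁻ x, b i x ∂μ) l (𝓝 (∫⁻ x, B x ∂μ))) :
    Tendsto (fun i => ∫⁻ x, e i x ∂μ) l (𝓝 0) := by
  have trunc {f : ι → α → ℝ≥0∞} {g : α → ℝ≥0∞} (hf : ∀ i, AEMeasurable (f i) μ)
      (hlim : ∀ᵐ x ∂μ, Tendsto (fun i => f i x) l (𝓝 (g x))) :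
      Tendsto (fun i => ∫⁻ x, min (f i x) (B x) ∂μ) l (𝓝 (∫⁻ x, min (g x) (B x) ∂μ)) :=
    tendsto_lintegral_filter_of_dominated_convergence' B
      (.of_forall fun i => (hf i).min hB) (.of_forall fun i => .of_forall fun x => min_le_right _ _)
      hB_fin (hlim.mono fun x hx => hx.min tendsto_const_nhds)
  have excess (i : ι) :
      ∫⁻ x, (b i x - B x) ∂μ = ∫⁻ x, b i x ∂μ - ∫⁻ x, min (b i x) (B x) ∂μ := by
    refine ENNReal.eq_sub_of_add_eq
      ((lintegral_mono fun x => min_le_right _ _).trans_lt hB_fin.lt_top).ne ?_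
    rw [← lintegral_add_right' _ ((hb i).min hB)]
    exact lintegral_congr fun x => tsub_add_min
  have excess_lim : Tendsto (fun i => ∫⁻ x, (b i x - B x) ∂μ) l (𝓝 0) := by
    simpa [excess] using ENNReal.Tendsto.sub hb_int (trunc hb hb_lim) (Or.inl hB_fin)
  have bound (i : ι) :
      ∫⁻ x, e i x ∂μ ≤ ∫⁻ x, min (e i x) (B x) ∂μ + ∫⁻ x, (b i x - B x) ∂μ := by
    rw [← lintegral_add_left' ((he i).min hB)]
    refine lintegral_mono fun x => ?_
    rcases le_total (e i x) (B x) with h | h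
    · simp [h]
    · simpa [h] using (hle i x).trans le_add_tsub
  refine tendsto_of_tendsto_of_tendsto_of_le_of_le tendsto_const_nhds ?_ (fun _ => zero_le) bound
  simpa using (trunc he he_lim).add excess_lim

theorem tendsto_eLpNorm_sub_of_ae [l.IsCountablyGenerated] {q : ℝ≥0} (hq : 1 ≤ q)
    {u : ι → α → F} {w : α → F} (hu : ∀ i, AEStronglyMeasurable (u i) μ) (hw : MemLp w q μ)
    (hae : ∀ᵐ x ∂μ, Tendsto (fun i => u i x) l (𝓝 (w x)))
    (hnorm : Tendsto (fun i => eLpNorm (u i) q μ) l (𝓝 (eLpNorm w q μ))) :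
    Tendsto (fun i => eLpNorm (u i - w) q μ) l (𝓝 0) := by
  have hq0 : q ≠ 0 := (zero_lt_one.trans_le hq).ne'
  have hq' : (0 : ℝ) < q := by positivity
  have hpow {f : α → F} (hf : AEStronglyMeasurable f μ) :
      AEMeasurable (fun x => ‖f x‖ₑ ^ (q : ℝ)) μ := hf.enorm.pow_const _
  let b (f : α → F) (x : α) : ℝ≥0∞ := 2 ^ ((q : ℝ) - 1) * (‖f x‖ₑ ^ (q : ℝ) + ‖w x‖ₑ ^ (q : ℝ))
  have hb {f : α → F} (hf : AEStronglyMeasurable f μ) : AEMeasurable (b f) μ :=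
    ((hpow hf).add (hpow hw.aestronglyMeasurable)).const_mul _
  have int_b (f : α → F) : ∫⁻ x, b f x ∂μ
      = 2 ^ ((q : ℝ) - 1) * (eLpNorm f q μ ^ (q : ℝ) + eLpNorm w q μ ^ (q : ℝ)) := by
    rw [lintegral_const_mul' _ _ (by finiteness),
      lintegral_add_right' _ (hpow hw.aestronglyMeasurable)]
    simp_rw [eLpNorm_nnreal_pow_eq_lintegral hq0]
  have hlim : Tendsto (fun i => ∫⁻ x, ‖(u i - w) x‖ₑ ^ (q : ℝ) ∂μ) l (𝓝 0) := by
    refine tendsto_lintegral_zero_of_le_of_tendsto (b := fun i => b (u i)) (B := b w)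
      (fun i => hpow ((hu i).sub hw.aestronglyMeasurable))
      (fun i => hb (hu i)) (hb hw.aestronglyMeasurable)
      (fun i x => (ENNReal.rpow_le_rpow enorm_sub_le hq'.le).trans
        (ENNReal.rpow_add_le_mul_rpow_add_rpow _ _ (by exact_mod_cast hq))) ?_ ?_ ?_ ?_
    · filter_upwards [hae] with x hx
      exact ((ENNReal.continuous_rpow_const.comp continuous_enorm).tendsto' _ _
        (by simp [hq'])).comp (tendsto_sub_nhds_zero_iff.2 hx)
    · filter_upwards [hae] with x hx
      exact ENNReal.Tendsto.const_mul ((hx.enorm.ennrpow_const _).add_const _)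
        (Or.inr (by finiteness))
    · have := hw.eLpNorm_ne_top
      rw [int_b]
      finiteness
    · simp_rw [int_b]
      exact ENNReal.Tendsto.const_mul ((hnorm.ennrpow_const _).add_const _)
        (Or.inr (by finiteness))
  simp_rw [← eLpNorm_nnreal_pow_eq_lintegral hq0] at hlim
  simpa [ENNReal.rpow_rpow_inv hq'.ne', ENNReal.zero_rpow_of_pos (inv_pos.2 hq')]
    using hlim.ennrpow_const (q : ℝ)⁻¹

theorem tendsto_eLpNorm_sub_of_tendstoInMeasure {q : ℝ≥0} (hq : 1 ≤ q) {u : ℕ → α → F} {w : α → F}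
    (hu : ∀ k, AEStronglyMeasurable (u k) μ) (hw : MemLp w q μ) (hm : TendstoInMeasure μ u atTop w)
    (hnorm : Tendsto (fun k => eLpNorm (u k) q μ) atTop (𝓝 (eLpNorm w q μ))) :
    Tendsto (fun k => eLpNorm (u k - w) q μ) atTop (𝓝 0) := by
  refine tendsto_of_subseq_tendsto fun ns hns => ?_
  have hm' : TendstoInMeasure μ (fun k => u (ns k)) atTop w := fun ε hε => (hm ε hε).comp hns
  obtain ⟨ms, hms, hae⟩ := hm'.exists_seq_tendsto_ae
  exact ⟨ms, tendsto_eLpNorm_sub_of_ae hq (fun k => hu (ns (ms k))) hw hae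
    (hnorm.comp (hns.comp hms.tendsto_atTop))⟩

theorem lintegral_lintegral_closedBall {G : Type*} [NormedAddCommGroup G] [MeasurableSpace G]
    [BorelSpace G] [SecondCountableTopology G] {ν : Measure G} [SFinite ν]
    [ν.IsAddLeftInvariant] {h : G → ℝ≥0∞} (hh : AEMeasurable h ν) (r : ℝ) :
    ∫⁻ y, ∫⁻ x in Metric.closedBall y r, h x ∂ν ∂ν
      = ν (Metric.closedBall 0 r) * ∫⁻ x, h x ∂ν := by
  have hball (x : G) : ν (Metric.closedBall x r) = ν (Metric.closedBall 0 r) := by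
    rw [← measure_preimage_add ν x, preimage_add_closedBall]
    simp
  have hset : MeasurableSet {z : G × G | z.2 ∈ Metric.closedBall z.1 r} := by
    simp_rw [Metric.mem_closedBall]
    exact measurableSet_le (by fun_prop) measurable_const
  calc ∫⁻ y, ∫⁻ x in Metric.closedBall y r, h x ∂ν ∂ν
      = ∫⁻ y, ∫⁻ x, (Metric.closedBall y r).indicator h x ∂ν ∂ν := by
        simp_rw [lintegral_indicator Metric.isClosed_closedBall.measurableSet]
    _ = ∫⁻ x, ∫⁻ y, (Metric.closedBall y r).indicator h x ∂ν ∂ν :=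
        lintegral_lintegral_swap (hh.comp_snd.indicator hset)
    _ = ∫⁻ x, ∫⁻ y, (Metric.closedBall x r).indicator (fun _ => h x) y ∂ν ∂ν := by
        simp only [Set.indicator, Metric.mem_closedBall, dist_comm]
    _ = ∫⁻ x, h x * ν (Metric.closedBall 0 r) ∂ν := by
        simp_rw [lintegral_indicator Metric.isClosed_closedBall.measurableSet, setLIntegral_const,
          hball]
    _ = ν (Metric.closedBall 0 r) * ∫⁻ x, h x ∂ν := by
        rw [lintegral_mul_const'' _ hh, mul_comm]

theorem lintegral_eLpNorm_restrict_closedBall_rpow {G : Type*} [NormedAddCommGroup G]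
    [MeasurableSpace G] [BorelSpace G] [SecondCountableTopology G] {ν : Measure G} [SFinite ν]
    [ν.IsAddLeftInvariant] {p : ℝ≥0} (hp : p ≠ 0) {h : G → F} (hh : AEStronglyMeasurable h ν)
    (r : ℝ) :
    ∫⁻ y, eLpNorm h p (ν.restrict (Metric.closedBall y r)) ^ (p : ℝ) ∂ν =
      ν (Metric.closedBall 0 r) * eLpNorm h p ν ^ (p : ℝ) := by
  simp_rw [eLpNorm_nnreal_pow_eq_lintegral hp]
  exact lintegral_lintegral_closedBall (hh.enorm.pow_const _) r

theorem exists_tendsto_eLpNorm_sub_of_cauchy [CompleteSpace F] {q : ℝ≥0∞} (hq : 1 ≤ q)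
    {u : ℕ → α → F} (hu : ∀ k, MemLp (u k) q μ)
    (hcauchy : Tendsto (fun m : ℕ × ℕ => eLpNorm (u m.1 - u m.2) q μ) (atTop ×ˢ atTop) (𝓝 0)) :
    ∃ U, MemLp U q μ ∧ Tendsto (fun k => eLpNorm (u k - U) q μ) atTop (𝓝 0) := by
  have : Fact (1 ≤ q) := ⟨hq⟩
  have hdist (m : ℕ × ℕ) : dist ((hu m.1).toLp (u m.1)) ((hu m.2).toLp (u m.2)) =
      (eLpNorm (u m.1 - u m.2) q μ).toReal := by
    rw [dist_eq_norm, ← MemLp.toLp_sub, Lp.norm_toLp]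
  have hseq : CauchySeq fun k => (hu k).toLp (u k) := by
    rw [cauchySeq_iff_tendsto_dist_atTop_0, ← prod_atTop_atTop_eq]
    simp_rw [hdist]
    exact (ENNReal.tendsto_toReal ENNReal.zero_ne_top).comp hcauchy
  obtain ⟨U, hU⟩ := cauchySeq_tendsto_of_complete hseq
  refine ⟨U, Lp.memLp U, ?_⟩
  rw [Lp.tendsto_Lp_iff_tendsto_eLpNorm'] at hU
  exact hU.congr fun k => eLpNorm_congr_ae ((hu k).coeFn_toLp.sub (ae_eq_refl _))

end Lebesgue

section DirectionalDilation

theorem eLpNorm_norm_add_mul_norm_le {α F F' : Type*} [MeasurableSpace α] {μ : Measure α}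
    [NormedAddCommGroup F] [NormedAddCommGroup F'] {p : ℝ≥0∞} (hp : 1 ≤ p) {a : α → F} {b : α → F'}
    (ha : AEStronglyMeasurable a μ) (hb : AEStronglyMeasurable b μ) (K : ℝ≥0) :
    eLpNorm (fun x => ‖a x‖ + K * ‖b x‖) p μ ≤ eLpNorm a p μ + K * eLpNorm b p μ := by
  have hsmul : eLpNorm (fun x => (K : ℝ) * ‖b x‖) p μ = K * eLpNorm b p μ := by
    simpa [Real.enorm_eq_ofReal, Pi.smul_def] using
      eLpNorm_const_smul (c := (K : ℝ)) (f := fun x => ‖b x‖) (p := p) (μ := μ)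
  refine (eLpNorm_add_le ha.norm (hb.norm.const_mul _) hp).trans_eq ?_
  rw [eLpNorm_norm, hsmul]

variable {E F : Type*} [NormedAddCommGroup E] [NormedAddCommGroup F]

section LinearMap

variable [NormedSpace ℝ E] [FiniteDimensional ℝ E] [MeasurableSpace E] [BorelSpace E]
  (μ : Measure E) [μ.IsAddHaarMeasure]

theorem eLpNorm_comp_linearMap {A : E →ₗ[ℝ] E} (hA : LinearMap.det A ≠ 0) {p : ℝ≥0∞}
    (hp : p ≠ ⊤) {h : E → F} (hh : AEStronglyMeasurable h μ) :
    eLpNorm (fun x => h (A x)) p μ =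
      ENNReal.ofReal |(LinearMap.det A)⁻¹| ^ p.toReal⁻¹ * eLpNorm h p μ := by
  have hmap := Measure.map_linearMap_addHaar_eq_smul_addHaar μ hA
  have hA_meas : AEMeasurable A μ := A.continuous_of_finiteDimensional.aemeasurable
  rw [← Function.comp_def, ← eLpNorm_map_measure (hmap ▸ hh.smul_measure _) hA_meas, hmap,
    eLpNorm_smul_measure_of_ne_top hp]
  simp

end LinearMap

variable [InnerProductSpace ℝ E]

/-- The linear map dilating by `l` along `v` and fixing the orthogonal complement of `v`, for a
unit vector `v`. -/
def directionalDilation (v : E) (l : ℝ) : E →ₗ[ℝ] E :=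
  LinearMap.transvection ((l - 1) • (innerSL ℝ v).toLinearMap) v

theorem directionalDilation_apply (v : E) (l : ℝ) (x : E) :
    directionalDilation v l x = x + ((l - 1) * inner ℝ v x) • v := by
  simp [directionalDilation, LinearMap.transvection.apply]

variable [FiniteDimensional ℝ E]

theorem det_directionalDilation {v : E} (hv : ‖v‖ = 1) (l : ℝ) :
    LinearMap.det (directionalDilation v l) = l := by
  simp [directionalDilation, hv]

theorem norm_fderiv_comp_directionalDilation_le [NormedSpace ℝ F] {v : E} (hv : ‖v‖ = 1) {l : ℝ≥0}
    (hl : 1 ≤ l) {f : E → F} (hf : Differentiable ℝ f) (x : E) :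
    ‖fderiv ℝ (fun x => f (directionalDilation v l x)) x‖ ≤
      ‖fderiv ℝ f (directionalDilation v l x)‖ +
        l * ‖fderiv ℝ f (directionalDilation v l x) v‖ := by
  have hl' : (1 : ℝ) ≤ l := by exact_mod_cast hl
  have hderiv : HasFDerivAt (fun x => f (directionalDilation v l x))
      ((fderiv ℝ f (directionalDilation v l x)).comp
        (LinearMap.toContinuousLinearMap (directionalDilation v l))) x :=
    (hf _).hasFDerivAt.comp x (LinearMap.toContinuousLinearMap _).hasFDerivAt
  refine ContinuousLinearMap.opNorm_le_bound _ (by positivity) fun z => ?_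
  have hz : ‖((l : ℝ) - 1) * inner ℝ v z‖ ≤ l * ‖z‖ := by
    rw [norm_mul, Real.norm_of_nonneg (sub_nonneg.2 hl')]
    have := norm_inner_le_norm (𝕜 := ℝ) v z
    rw [hv, one_mul] at this
    nlinarith [norm_nonneg (inner ℝ v z), norm_nonneg z]
  calc ‖fderiv ℝ (fun x => f (directionalDilation v l x)) x z‖
      = ‖fderiv ℝ f (directionalDilation v l x) z + (((l : ℝ) - 1) * inner ℝ v z) •
          fderiv ℝ f (directionalDilation v l x) v‖ := by
        rw [hderiv.fderiv]
        simp [directionalDilation_apply v l z]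
    _ ≤ ‖fderiv ℝ f (directionalDilation v l x)‖ * ‖z‖ +
          l * ‖z‖ * ‖fderiv ℝ f (directionalDilation v l x) v‖ := by
        refine (norm_add_le _ _).trans (add_le_add (ContinuousLinearMap.le_opNorm _ _) ?_)
        rw [norm_smul]
        gcongr
    _ = _ := by ring

variable [MeasurableSpace E] [BorelSpace E] (μ : Measure E) [μ.IsAddHaarMeasure]

theorem eLpNorm_comp_directionalDilation {v : E} (hv : ‖v‖ = 1) {l : ℝ≥0} (hl : 0 < l) (p : ℝ≥0)
    {h : E → F} (hh : AEStronglyMeasurable h μ) :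
    eLpNorm (fun x => h (directionalDilation v l x)) p μ =
      (l : ℝ≥0∞)⁻¹ ^ (p : ℝ)⁻¹ * eLpNorm h p μ := by
  have hdet : LinearMap.det (directionalDilation v l) = l := det_directionalDilation hv l
  rw [eLpNorm_comp_linearMap μ (by rw [hdet]; exact_mod_cast hl.ne') ENNReal.coe_ne_top hh, hdet,
    abs_of_pos (by positivity), ENNReal.ofReal_inv_of_pos (by positivity)]
  simp

theorem eLpNorm_fderiv_comp_directionalDilation_le [NormedSpace ℝ F] {v : E} (hv : ‖v‖ = 1)
    {l : ℝ≥0} (hl : 1 ≤ l) {p : ℝ≥0} (hp : 1 ≤ p) {f : E → F} (hf : ContDiff ℝ 1 f) :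
    eLpNorm (fderiv ℝ fun x => f (directionalDilation v l x)) p μ ≤ (l : ℝ≥0∞)⁻¹ ^ (p : ℝ)⁻¹ *
      (eLpNorm (fderiv ℝ f) p μ + l * eLpNorm (fun x => fderiv ℝ f x v) p μ) := by
  have hf' : Continuous (fderiv ℝ f) := hf.continuous_fderiv (by simp)
  have hf'v : Continuous fun x => fderiv ℝ f x v := hf'.clm_apply continuous_const
  refine (eLpNorm_mono_real (norm_fderiv_comp_directionalDilation_le hv hl
    (hf.differentiable (by simp)))).trans ?_
  rw [eLpNorm_comp_directionalDilation μ hv (zero_lt_one.trans_le hl) p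
    (h := fun x => ‖fderiv ℝ f x‖ + l * ‖fderiv ℝ f x v‖)
    (hf'.norm.add (continuous_const.mul hf'v.norm)).aestronglyMeasurable]
  gcongr
  exact eLpNorm_norm_add_mul_norm_le (by exact_mod_cast hp) hf'.aestronglyMeasurable
    hf'v.aestronglyMeasurable l

theorem exists_eLpNorm_le_mul_inv_rpow_mul_eLpNorm_fderiv_add [NormedSpace ℝ F]
    [FiniteDimensional ℝ F] {p q : ℝ≥0} (hp : 1 ≤ p) (hE : 0 < Module.finrank ℝ E)
    (hpq : (q : ℝ)⁻¹ = (p : ℝ)⁻¹ - (Module.finrank ℝ E : ℝ)⁻¹) {v : E} (hv : ‖v‖ = 1) :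
    ∃ C : ℝ≥0, ∀ l : ℝ≥0, 1 ≤ l → ∀ f : E → F, ContDiff ℝ 1 f → HasCompactSupport f →
      eLpNorm f q μ ≤ C * (l : ℝ≥0∞)⁻¹ ^ (Module.finrank ℝ E : ℝ)⁻¹ *
        (eLpNorm (fderiv ℝ f) p μ + l * eLpNorm (fun x => fderiv ℝ f x v) p μ) := by
  refine ⟨SNormLESNormFDerivOfEqConst F μ p, fun l hl f hf hf_supp => ?_⟩
  have hl0 : 0 < l := zero_lt_one.trans_le hl
  have hdet : LinearMap.det (directionalDilation v l) ≠ 0 := by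
    rw [det_directionalDilation hv]; exact_mod_cast hl0.ne'
  let A := (LinearMap.equivOfDetNeZero _ hdet).toContinuousLinearEquiv
  have hsobolev := eLpNorm_le_eLpNorm_fderiv_of_eq (μ := μ)
    (u := fun x => f (directionalDilation v l x)) (hf.comp (A.contDiff : ContDiff ℝ 1 A))
    (hf_supp.comp_homeomorph A.toHomeomorph) hp hE hpq
  rw [eLpNorm_comp_directionalDilation μ hv hl0 q hf.continuous.aestronglyMeasurable] at hsobolev
  have hc0 : (l : ℝ≥0∞)⁻¹ ≠ 0 := by simp
  have hct : (l : ℝ≥0∞)⁻¹ ≠ ⊤ := by simp [hl0.ne']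
  have hcq0 : (l : ℝ≥0∞)⁻¹ ^ (q : ℝ)⁻¹ ≠ 0 := by simp [ENNReal.rpow_eq_zero_iff, hc0, hct]
  have hcqt : (l : ℝ≥0∞)⁻¹ ^ (q : ℝ)⁻¹ ≠ ⊤ := ENNReal.rpow_ne_top_of_nonneg (by positivity) hct
  rw [← ENNReal.mul_le_mul_iff_right hcq0 hcqt]
  refine hsobolev.trans ((mul_le_mul_right
    (eLpNorm_fderiv_comp_directionalDilation_le μ hv hl hp hf) _).trans_eq ?_)
  rw [show (p : ℝ)⁻¹ = (q : ℝ)⁻¹ + (Module.finrank ℝ E : ℝ)⁻¹ by rw [hpq]; ring,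
    ENNReal.rpow_add _ _ hc0 hct]
  ring

end DirectionalDilation

namespace Torus

variable {n : ℕ}

section SmoothFunctions

instance : IsProbabilityMeasure (volume : Measure (Torus n)) :=
  have : IsProbabilityMeasure (volume : Measure UnitAddCircle) := ⟨UnitAddCircle.measure_univ⟩
  inferInstanceAs (IsProbabilityMeasure (Measure.pi fun _ : Fin n => volume))

instance : (volume : Measure (Torus n)).IsNegInvariant :=
  Measure.IsAddHaarMeasure.isNegInvariant_of_regular volume

theorem mk_add (x y : EuclideanSpace ℝ (Fin n)) : mk (x + y) = mk x + mk y := by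
  ext i; simp [mk]

theorem mk_sub (x y : EuclideanSpace ℝ (Fin n)) : mk (x - y) = mk x - mk y := by
  ext i; simp [mk]

theorem isOpenQuotientMap_mk : IsOpenQuotientMap (mk (n := n)) := by
  have h : IsOpenQuotientMap (Pi.map (fun (_ : Fin n) (s : ℝ) => (s : UnitAddCircle))) :=
    IsOpenQuotientMap.piMap fun _ => QuotientAddGroup.isOpenQuotientMap_mk
  exact h.comp (PiLp.homeomorph 2 (fun _ : Fin n => ℝ)).isOpenQuotientMap

theorem continuous_mk : Continuous (mk (n := n)) := isOpenQuotientMap_mk.continuous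

theorem surjective_mk : Function.Surjective (mk (n := n)) := isOpenQuotientMap_mk.surjective

theorem exists_mk_eq_norm_le (t : Torus n) :
    ∃ h : EuclideanSpace ℝ (Fin n), mk h = t ∧ ‖h‖ ≤ √n * ‖t‖ := by
  have lift (s : UnitAddCircle) : ∃ x : ℝ, (x : UnitAddCircle) = s ∧ |x| = ‖s‖ := by
    obtain ⟨x, rfl⟩ := QuotientAddGroup.mk_surjective s
    have hround : ((round x : ℝ) : UnitAddCircle) = 0 :=
      (AddCircle.coe_eq_zero_iff 1).2 ⟨round x, by simp⟩
    refine ⟨x - round x, ?_, UnitAddCircle.norm_eq.symm⟩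
    rw [AddCircle.coe_sub, hround, sub_zero]
  choose g hg_mk hg_abs using lift
  refine ⟨WithLp.toLp 2 fun i => g (t i), funext fun i => hg_mk (t i), ?_⟩
  rw [EuclideanSpace.norm_eq]
  refine Real.sqrt_le_iff.2 ⟨by positivity, ?_⟩
  calc ∑ i, ‖g (t i)‖ ^ 2 ≤ ∑ _i : Fin n, ‖t‖ ^ 2 := by
        gcongr with i
        rw [Real.norm_eq_abs, hg_abs]
        exact norm_le_pi_norm t i
    _ = (√n * ‖t‖) ^ 2 := by
        rw [mul_pow, Real.sq_sqrt (Nat.cast_nonneg n)]; simp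

/-- The half-open unit cube with lower corner `a`. -/
def cube (a : Fin n → ℝ) : Set (EuclideanSpace ℝ (Fin n)) :=
  {x | ∀ i, x i ∈ Set.Ioc (a i) (a i + 1)}

theorem measurePreserving_mk (a : Fin n → ℝ) :
    MeasurePreserving (mk (n := n)) (volume.restrict (cube a)) volume := by
  have hquot := measurePreserving_pi _ _ fun i : Fin n => UnitAddCircle.measurePreserving_mk (a i)
  rw [← Measure.restrict_pi_pi] at hquot
  have hcube : (WithLp.ofLp ⁻¹' Set.univ.pi fun i => Set.Ioc (a i) (a i + 1)) = cube a := by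
    ext x; simp [cube]
  have hofLp := (PiLp.volume_preserving_ofLp (Fin n)).restrict_preimage
    (s := Set.univ.pi fun i => Set.Ioc (a i) (a i + 1))
    (MeasurableSet.univ_pi fun i => measurableSet_Ioc)
  rw [hcube] at hofLp
  exact hquot.comp hofLp

theorem exists_map_restrict_mk_le {S : Set (EuclideanSpace ℝ (Fin n))}
    (hS : Bornology.IsBounded S) :
    ∃ N : ℝ≥0, Measure.map mk (volume.restrict S) ≤ N • (volume : Measure (Torus n)) := by
  obtain ⟨R, hR⟩ := hS.exists_norm_le
  let I : Finset (Fin n → ℤ) := Fintype.piFinset fun _ => Finset.Icc ⌈-R - 1⌉ ⌊R⌋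
  have hcov : S ⊆ ⋃ a ∈ I, cube fun i => (a i : ℝ) := by
    intro x hx
    have hxR (i : Fin n) := abs_le.1 ((PiLp.norm_apply_le x i).trans (hR x hx))
    have hceil (i : Fin n) := And.intro (Int.le_ceil (x i)) (Int.ceil_lt_add_one (x i))
    refine Set.mem_biUnion (x := fun i => ⌈x i⌉ - 1) (Fintype.mem_piFinset.2 fun i => ?_)
      fun i => ?_
    · rw [Finset.mem_Icc, Int.ceil_le, Int.le_floor]
      push_cast
      constructor <;> linarith [hxR i, hceil i]
    · push_cast
      constructor <;> linarith [hceil i]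
  refine ⟨I.card, Measure.le_iff.2 fun B hB => ?_⟩
  have hB' := continuous_mk.measurable hB
  calc Measure.map mk (volume.restrict S) B
      = volume (mk ⁻¹' B ∩ S) := by
        rw [Measure.map_apply continuous_mk.measurable hB, Measure.restrict_apply hB']
    _ ≤ volume (⋃ a ∈ I, mk ⁻¹' B ∩ cube fun i => (a i : ℝ)) := by
        rw [← Set.inter_iUnion₂]
        gcongr
    _ ≤ ∑ a ∈ I, volume (mk ⁻¹' B ∩ cube fun i => (a i : ℝ)) := measure_biUnion_finset_le _ _
    _ = ∑ _a ∈ I, volume B := by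
        refine Finset.sum_congr rfl fun a _ => ?_
        rw [← Measure.restrict_apply hB']
        exact (measurePreserving_mk _).measure_preimage hB.nullMeasurableSet
    _ = ((I.card : ℝ≥0) • volume) B := by simp [ENNReal.smul_def]

theorem volume_closedBall (t : Torus n) {r : ℝ} (hr : 0 ≤ r) (hr' : r ≤ 1 / 2) :
    volume (Metric.closedBall t r) = ENNReal.ofReal (2 * r) ^ n := by
  have hcircle (s : UnitAddCircle) : volume (Metric.closedBall s r) = ENNReal.ofReal (2 * r) := by
    rw [AddCircle.volume_closedBall, min_eq_right (by linarith)]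
  simp [MeasureTheory.volume_pi_closedBall t hr, hcircle]

theorem integrable_smul_of_continuous {F : Type*} [NormedAddCommGroup F] [NormedSpace ℝ F]
    {b : Torus n → ℝ} (hb : Integrable b volume) {c : Torus n → F} (hc : Continuous c) :
    Integrable (fun t => b t • c t) volume :=
  let ⟨K, hK⟩ := isCompact_univ.exists_bound_of_continuousOn hc.continuousOn
  hb.smul_bdd K hc.aestronglyMeasurable (.of_forall fun t => hK t trivial)

/-- `f` is continuously differentiable on the torus, with classical gradient `f'`. The constructor
is not called `mk` because it would hide `Torus.mk` in the namespace of this structure. -/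
structure HasC1Deriv (f : Torus n → ℝ) (f' : Torus n → EuclideanSpace ℝ (Fin n)) : Prop where
  intro ::
  continuous_deriv : Continuous f'
  hasFDerivAt : ∀ x, HasFDerivAt (fun x => f (mk x)) (innerSL ℝ (f' (mk x))) x

variable {f g : Torus n → ℝ} {f' g' : Torus n → EuclideanSpace ℝ (Fin n)}

theorem HasC1Deriv.continuous_lift (hf : HasC1Deriv f f') : Continuous fun x => f (mk x) :=
  continuous_iff_continuousAt.2 fun x => (hf.hasFDerivAt x).continuousAt

theorem HasC1Deriv.continuous (hf : HasC1Deriv f f') : Continuous f :=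
  isOpenQuotientMap_mk.isQuotientMap.continuous_iff.2 hf.continuous_lift

theorem HasC1Deriv.fderiv_lift (hf : HasC1Deriv f f') :
    fderiv ℝ (fun x => f (mk x)) = fun x => innerSL ℝ (f' (mk x)) :=
  funext fun x => (hf.hasFDerivAt x).fderiv

theorem HasC1Deriv.contDiff_lift (hf : HasC1Deriv f f') : ContDiff ℝ 1 fun x => f (mk x) := by
  rw [contDiff_one_iff_fderiv]
  refine ⟨fun x => (hf.hasFDerivAt x).differentiableAt, ?_⟩
  rw [hf.fderiv_lift]
  exact (innerSL ℝ).continuous.comp (hf.continuous_deriv.comp continuous_mk)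

theorem HasC1Deriv.mul (hf : HasC1Deriv f f') (hg : HasC1Deriv g g') :
    HasC1Deriv (fun t => f t * g t) (fun t => f t • g' t + g t • f' t) where
  continuous_deriv := (hf.continuous.smul hg.continuous_deriv).add
    (hg.continuous.smul hf.continuous_deriv)
  hasFDerivAt x := by
    refine ((hf.hasFDerivAt x).mul (hg.hasFDerivAt x)).congr_fderiv ?_
    simp

theorem HasC1Deriv.comp_sub_const (hf : HasC1Deriv f f') (y : Torus n) :
    HasC1Deriv (fun t => f (t - y)) (fun t => f' (t - y)) where
  continuous_deriv := hf.continuous_deriv.comp (continuous_id.sub continuous_const)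
  hasFDerivAt x := by
    obtain ⟨y, rfl⟩ := surjective_mk y
    simp_rw [← mk_sub]
    exact ((hf.hasFDerivAt (x - y)).comp x ((hasFDerivAt_id x).sub_const y)).congr_fderiv
      (ContinuousLinearMap.comp_id _)

theorem HasC1Deriv.comp_const_sub (hf : HasC1Deriv f f') (y : Torus n) :
    HasC1Deriv (fun t => f (y - t)) (fun t => -f' (y - t)) where
  continuous_deriv := (hf.continuous_deriv.comp (continuous_sub_left y)).neg
  hasFDerivAt x := by
    obtain ⟨y, rfl⟩ := surjective_mk y
    simp_rw [← mk_sub]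
    exact ((hf.hasFDerivAt (y - x)).comp x ((hasFDerivAt_id x).const_sub y)).congr_fderiv
      (by ext; simp)

theorem HasC1Deriv.partialDeriv_eq (hf : HasC1Deriv f f') (i : Fin n) (t : Torus n) :
    partialDeriv i f t = f' t i := by
  obtain ⟨x, rfl⟩ := surjective_mk t
  have hline : HasDerivAt (fun s : ℝ => x + EuclideanSpace.single i s)
      (EuclideanSpace.single i (1 : ℝ)) 0 := by
    have h := ((hasDerivAt_id (0 : ℝ)).smul_const (EuclideanSpace.single i (1 : ℝ))).const_add x
    rw [one_smul] at h
    refine h.congr_of_eventuallyEq (.of_forall fun s => ?_)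
    ext j
    by_cases hj : j = i <;> simp [hj]
  have hcomp := (hf.hasFDerivAt x).comp_hasDerivAt_of_eq (0 : ℝ) hline (by simp)
  simp_rw [partialDeriv, ← mk_add]
  rw [Function.comp_def] at hcomp
  rw [hcomp.deriv]
  simp [EuclideanSpace.inner_single_right]

theorem IsSmooth.exists_hasC1Deriv {φ : Torus n → ℝ} (hφ : IsSmooth φ) :
    ∃ φ', HasC1Deriv φ φ' := by
  let D : EuclideanSpace ℝ (Fin n) → EuclideanSpace ℝ (Fin n) := fun x =>
    (InnerProductSpace.toDual ℝ _).symm (fderiv ℝ (fun x => φ (mk x)) x)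
  have hD_periodic {x y : EuclideanSpace ℝ (Fin n)} (hxy : mk x = mk y) : D x = D y := by
    have hshift : (fun z => φ (mk (z + (x - y)))) = fun z => φ (mk z) := by
      simp [mk_add, mk_sub, hxy]
    have h := fderiv_comp_add_right (𝕜 := ℝ) (f := fun z => φ (mk z)) (x := y) (x - y)
    rw [hshift, add_sub_cancel] at h
    simp only [D, h]
  let φ' : Torus n → EuclideanSpace ℝ (Fin n) := fun t => D (Function.surjInv surjective_mk t)
  have hφ' (x : EuclideanSpace ℝ (Fin n)) : φ' (mk x) = D x :=
    hD_periodic (Function.surjInv_eq surjective_mk _)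
  refine ⟨φ', isOpenQuotientMap_mk.isQuotientMap.continuous_iff.2 ?_, fun x => ?_⟩
  · rw [show φ' ∘ mk = D from funext hφ']
    exact (InnerProductSpace.toDual ℝ _).symm.continuous.comp (hφ.continuous_fderiv (by simp))
  · rw [hφ']
    refine (hφ.differentiable (by simp) x).hasFDerivAt.congr_fderiv ?_
    ext z
    simp [D]

theorem IsSmooth.continuous {φ : Torus n → ℝ} (hφ : IsSmooth φ) : Continuous φ :=
  let ⟨_, h⟩ := hφ.exists_hasC1Deriv
  h.continuous

/-- A smooth bump on the circle, equal to `1` on the ball of radius `r` about `0` and to `0` off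
the ball of radius `2 r`, for `0 < r ≤ 1 / 4`; the smoothness in `s` comes from
`cos (2 π ‖s‖) = cos (2 π s)`. -/
def circleBump (r : ℝ) (s : UnitAddCircle) : ℝ :=
  Real.smoothTransition ((Real.cos (2 * Real.pi * ‖s‖) - Real.cos (2 * Real.pi * (2 * r))) /
    (Real.cos (2 * Real.pi * r) - Real.cos (2 * Real.pi * (2 * r))))

theorem cos_two_pi_norm (x : ℝ) :
    Real.cos (2 * Real.pi * ‖(x : UnitAddCircle)‖) = Real.cos (2 * Real.pi * x) := by
  rw [UnitAddCircle.norm_eq, ← abs_of_pos (by positivity : 0 < 2 * Real.pi), ← abs_mul,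
    Real.cos_abs, abs_of_pos (by positivity : 0 < 2 * Real.pi), mul_sub,
    mul_comm (2 * Real.pi) (round x : ℝ), Real.cos_sub_int_mul_two_pi]

theorem circle_norm_le_half (s : UnitAddCircle) : ‖s‖ ≤ 1 / 2 := by
  have := AddCircle.norm_le_half_period (1 : ℝ) (x := s) one_ne_zero
  simpa using this

theorem cos_two_pi_sub_pos {r : ℝ} (hr : 0 < r) (hr' : r ≤ 1 / 4) :
    0 < Real.cos (2 * Real.pi * r) - Real.cos (2 * Real.pi * (2 * r)) := by
  have hpi := Real.pi_pos
  exact sub_pos.2 (Real.strictAntiOn_cos ⟨by positivity, by nlinarith⟩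
    ⟨by positivity, by nlinarith⟩ (by nlinarith))

theorem circleBump_eq_one {r : ℝ} (hr : 0 < r) (hr' : r ≤ 1 / 4) {s : UnitAddCircle}
    (hs : ‖s‖ ≤ r) : circleBump r s = 1 := by
  have hpi := Real.pi_pos
  refine Real.smoothTransition.one_of_one_le ?_
  rw [one_le_div (cos_two_pi_sub_pos hr hr')]
  refine sub_le_sub_right (Real.antitoneOn_cos ⟨by positivity, ?_⟩ ⟨by positivity, ?_⟩ ?_) _
  · nlinarith [circle_norm_le_half s]
  · nlinarith
  · gcongr

theorem circleBump_eq_zero {r : ℝ} (hr : 0 < r) (hr' : r ≤ 1 / 4) {s : UnitAddCircle}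
    (hs : 2 * r ≤ ‖s‖) : circleBump r s = 0 := by
  have hpi := Real.pi_pos
  refine Real.smoothTransition.zero_of_nonpos
    (div_nonpos_of_nonpos_of_nonneg ?_ (cos_two_pi_sub_pos hr hr').le)
  refine sub_nonpos.2 (Real.antitoneOn_cos ⟨by positivity, ?_⟩ ⟨by positivity, ?_⟩ ?_)
  · nlinarith
  · nlinarith [circle_norm_le_half s]
  · gcongr

/-- A smooth bump on the torus, equal to `1` on the ball of radius `r` about `0` and to `0` off the
ball of radius `2 r`, for `0 < r ≤ 1 / 4`. -/
def bump (r : ℝ) (t : Torus n) : ℝ := ∏ i, circleBump r (t i)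

theorem bump_nonneg (r : ℝ) (t : Torus n) : 0 ≤ bump r t :=
  Finset.prod_nonneg fun _ _ => Real.smoothTransition.nonneg _

theorem bump_le_one (r : ℝ) (t : Torus n) : bump r t ≤ 1 :=
  Finset.prod_le_one (fun _ _ => Real.smoothTransition.nonneg _)
    fun _ _ => Real.smoothTransition.le_one _

theorem bump_eq_one {r : ℝ} (hr : 0 < r) (hr' : r ≤ 1 / 4) {t : Torus n} (ht : ‖t‖ ≤ r) :
    bump r t = 1 :=
  Finset.prod_eq_one fun i _ => circleBump_eq_one hr hr' ((norm_le_pi_norm t i).trans ht)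

theorem bump_eq_zero {r : ℝ} (hr : 0 < r) (hr' : r ≤ 1 / 4) {t : Torus n} (ht : 2 * r ≤ ‖t‖) :
    bump r t = 0 := by
  contrapose! ht
  refine (pi_norm_lt_iff (by positivity)).2 fun i => ?_
  contrapose! ht
  exact Finset.prod_eq_zero (Finset.mem_univ i) (circleBump_eq_zero hr hr' ht)

theorem isSmooth_bump (r : ℝ) : IsSmooth (bump r : Torus n → ℝ) := by
  unfold IsSmooth bump circleBump
  refine contDiff_prod fun i _ => Real.smoothTransition.contDiff.comp ?_
  have : (fun x : EuclideanSpace ℝ (Fin n) => Real.cos (2 * Real.pi * ‖mk x i‖)) =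
      fun x => Real.cos (2 * Real.pi * x i) := funext fun x => cos_two_pi_norm (x i)
  refine ContDiff.div_const (ContDiff.sub ?_ contDiff_const) _
  rw [this]
  exact Real.contDiff_cos.comp
    (contDiff_const.mul (EuclideanSpace.proj i : EuclideanSpace ℝ (Fin n) →L[ℝ] ℝ).contDiff)

end SmoothFunctions

section Mollification

open scoped Convolution

variable {F : Type*} [NormedAddCommGroup F]

theorem tendsto_eLpNorm_translate_sub {p : ℝ≥0∞} (hp : 1 ≤ p) (hpt : p ≠ ⊤) {u : Torus n → F}
    (hu : MemLp u p volume) :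
    Tendsto (fun z : Torus n => eLpNorm (fun x => u (x - z) - u x) p volume) (𝓝 0) (𝓝 0) := by
  have : Fact (1 ≤ p) := ⟨hp⟩
  let g : C(Torus n, C(Torus n, Torus n)) :=
    ContinuousMap.curry ⟨fun a : Torus n × Torus n => a.2 - a.1, by fun_prop⟩
  have hg (z : Torus n) : MeasurePreserving (g z) volume volume :=
    measurePreserving_sub_right volume z
  have hcoe (z : Torus n) :
      Lp.compMeasurePreserving (g z) (hg z) (hu.toLp u) =ᵐ[volume] fun x => u (x - z) :=
    (Lp.coeFn_compMeasurePreserving (hu.toLp u) (hg z)).trans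
      ((hg z).quasiMeasurePreserving.ae_eq_comp hu.coeFn_toLp)
  have hlim := Tendsto.compMeasurePreservingLp (μ := volume) (ν := volume)
    (f := fun _ : Torus n => hu.toLp u) tendsto_const_nhds (g.continuous.tendsto 0) hg (hg 0) hpt
  rw [Lp.tendsto_Lp_iff_tendsto_eLpNorm'] at hlim
  refine hlim.congr fun z => eLpNorm_congr_ae ?_
  filter_upwards [hcoe z, hcoe 0] with x hz h0
  rw [Pi.sub_apply, hz, h0, sub_zero]

/-- The bump `bump r` normalized to have integral one: the kernel of the mollification
`mollifier r ⋆ u`. -/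
def mollifier (r : ℝ) (t : Torus n) : ℝ := bump r t / ∫ s : Torus n, bump r s

theorem isSmooth_mollifier (r : ℝ) : IsSmooth (mollifier r : Torus n → ℝ) :=
  ContDiff.div_const (isSmooth_bump r) _

theorem mollifier_nonneg (r : ℝ) (t : Torus n) : 0 ≤ mollifier r t :=
  div_nonneg (bump_nonneg r t) (integral_nonneg (bump_nonneg r))

theorem integral_mollifier {r : ℝ} (hr : 0 < r) (hr' : r ≤ 1 / 4) :
    ∫ t : Torus n, mollifier r t = 1 := by
  have hpos : 0 < ∫ s : Torus n, bump r s := by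
    refine (isSmooth_bump r).continuous.integral_pos_of_hasCompactSupport_nonneg_nonzero
      (.of_compactSpace _) (bump_nonneg r) (x := 0) ?_
    simp [bump_eq_one hr hr' (t := (0 : Torus n)) (by simpa using hr.le)]
  simp_rw [mollifier, integral_div, div_self hpos.ne']

/-- The probability measure on the torus with density `mollifier r`. -/
def mollifierMeasure (n : ℕ) (r : ℝ) : Measure (Torus n) :=
  volume.withDensity fun t => ((mollifier r t).toNNReal : ℝ≥0∞)

theorem measurable_toNNReal_mollifier (r : ℝ) :
    Measurable fun t : Torus n => (mollifier r t).toNNReal :=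
  (isSmooth_mollifier r).continuous.measurable.real_toNNReal

theorem isProbabilityMeasure_mollifierMeasure {r : ℝ} (hr : 0 < r) (hr' : r ≤ 1 / 4) :
    IsProbabilityMeasure (mollifierMeasure n r) := by
  have h := ofReal_integral_eq_lintegral_ofReal (μ := volume)
    ((isSmooth_mollifier (n := n) r).continuous.integrable_of_hasCompactSupport
      (.of_compactSpace _)) (.of_forall (mollifier_nonneg r))
  rw [integral_mollifier hr hr', ENNReal.ofReal_one] at h
  exact ⟨by simpa [mollifierMeasure, ENNReal.ofReal] using h.symm⟩

theorem ae_mollifierMeasure_norm_le {r : ℝ} (hr : 0 < r) (hr' : r ≤ 1 / 4) :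
    ∀ᵐ z ∂mollifierMeasure n r, ‖z‖ ≤ 2 * r := by
  rw [mollifierMeasure,
    ae_withDensity_iff (measurable_toNNReal_mollifier r).coe_nnreal_ennreal]
  refine .of_forall fun z hz => ?_
  contrapose! hz
  simp [mollifier, bump_eq_zero hr hr' hz.le]

variable [NormedSpace ℝ F]

theorem integral_mollifierMeasure (r : ℝ) (u : Torus n → F) (x : Torus n) :
    ∫ z, u (x - z) ∂mollifierMeasure n r = (mollifier r ⋆ u) x := by
  rw [mollifierMeasure, integral_withDensity_eq_integral_smul (measurable_toNNReal_mollifier r),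
    convolution_lsmul]
  simp [NNReal.smul_def, mollifier_nonneg]

theorem integrable_mollifierMeasure (r : ℝ) {u : Torus n → F} (hu : Integrable u volume)
    (x : Torus n) : Integrable (fun z => u (x - z)) (mollifierMeasure n r) := by
  rw [mollifierMeasure,
    integrable_withDensity_iff_integrable_smul (measurable_toNNReal_mollifier r)]
  have h := HasCompactSupport.convolutionExists_left (ContinuousLinearMap.lsmul ℝ ℝ)
    (.of_compactSpace _) (isSmooth_mollifier r).continuous hu.locallyIntegrable x
  simpa [ConvolutionExistsAt, NNReal.smul_def, mollifier_nonneg] using h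

theorem eLpNorm_mollifier_convolution_sub_le [CompleteSpace F] {p : ℝ≥0} (hp : 1 ≤ p)
    {u : Torus n → F} (hu : Integrable u volume) {r : ℝ} (hr : 0 < r) (hr' : r ≤ 1 / 4) {A : ℝ≥0∞}
    (hA : ∀ z : Torus n, ‖z‖ ≤ 2 * r → eLpNorm (fun x => u (x - z) - u x) p volume ≤ A) :
    eLpNorm (mollifier r ⋆ u - u) p volume ≤ A := by
  have := isProbabilityMeasure_mollifierMeasure (n := n) hr hr'
  have havg : mollifier r ⋆ u - u = fun x => ∫ z, (u (x - z) - u x) ∂mollifierMeasure n r := by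
    ext x
    rw [integral_sub (integrable_mollifierMeasure r hu x) (integrable_const _),
      integral_mollifierMeasure]
    simp
  have hmeas : AEStronglyMeasurable (Function.uncurry fun x z : Torus n => u (x - z) - u x)
      ((volume : Measure (Torus n)).prod (mollifierMeasure n r)) :=
    ((hu.aestronglyMeasurable.comp_quasiMeasurePreserving
      (quasiMeasurePreserving_sub_of_right_invariant volume volume)).mono_ac
      (Measure.AbsolutelyContinuous.rfl.prod (withDensity_absolutelyContinuous _ _))).sub
      hu.aestronglyMeasurable.comp_fst
  rw [havg]
  exact eLpNorm_integral_le hmeas hp ((ae_mollifierMeasure_norm_le hr hr').mono fun z hz => hA z hz)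

theorem tendsto_eLpNorm_mollifier_convolution_sub [CompleteSpace F] {p : ℝ≥0} (hp : 1 ≤ p)
    {u : Torus n → F} (hu : MemLp u p volume) :
    Tendsto (fun r => eLpNorm (mollifier r ⋆ u - u) p volume) (𝓝[>] 0) (𝓝 0) := by
  have hp' : (1 : ℝ≥0∞) ≤ p := by exact_mod_cast hp
  rw [ENNReal.tendsto_nhds_zero]
  intro ε hε
  obtain ⟨δ, hδ, hball⟩ := Metric.eventually_nhds_iff.1 (ENNReal.tendsto_nhds_zero.1
    (tendsto_eLpNorm_translate_sub hp' ENNReal.coe_ne_top hu) ε hε)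
  filter_upwards [Ioo_mem_nhdsGT (lt_min (by norm_num : (0 : ℝ) < 1 / 4) (half_pos hδ))]
    with r ⟨hr0, hr⟩
  rw [lt_min_iff] at hr
  refine eLpNorm_mollifier_convolution_sub_le hp (hu.integrable hp') hr0 hr.1.le
    fun z hz => hball ?_
  rw [dist_zero_right]
  linarith

theorem continuous_convolution {ρ : Torus n → ℝ} (hρ : Continuous ρ) {u : Torus n → F}
    (hu : Integrable u volume) : Continuous (ρ ⋆ u) :=
  HasCompactSupport.continuous_convolution_left (ContinuousLinearMap.lsmul ℝ ℝ)
    (.of_compactSpace _) hρ hu.locallyIntegrable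

theorem integrable_kernel_smul {ρ : Torus n → ℝ} (hρ : Continuous ρ) {u : Torus n → F}
    (hu : Integrable u volume) (t : Torus n) : Integrable (fun y => ρ (t - y) • u y) volume :=
  ((HasCompactSupport.convolutionExists_left (ContinuousLinearMap.lsmul ℝ ℝ)
    (.of_compactSpace _) hρ hu.locallyIntegrable) t).integrable_swap

theorem HasC1Deriv.hasFDerivAt_convolution {ρ : Torus n → ℝ}
    {ρ' : Torus n → EuclideanSpace ℝ (Fin n)} (hρ : HasC1Deriv ρ ρ') {w : Torus n → ℝ}
    (hw : Integrable w volume) (x : EuclideanSpace ℝ (Fin n)) :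
    HasFDerivAt (fun x => (ρ ⋆ w) (mk x)) (innerSL ℝ (∫ y, w y • ρ' (mk x - y))) x := by
  obtain ⟨K, hK⟩ := isCompact_univ.exists_bound_of_continuousOn hρ.continuous_deriv.continuousOn
  have hρ'_cont : Continuous fun y => ρ' (mk x - y) :=
    hρ.continuous_deriv.comp (continuous_sub_left _)
  have hint := integrable_kernel_smul hρ.continuous hw
  have hderiv := hasFDerivAt_integral_of_dominated_of_fderiv_le (𝕜 := ℝ) (μ := volume) (x₀ := x)
    (F := fun x y => ρ (mk x - y) • w y) (F' := fun x y => w y • innerSL ℝ (ρ' (mk x - y)))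
    (bound := fun y => ‖w y‖ * K) univ_mem
    (.of_forall fun x => (hint _).aestronglyMeasurable) (hint _)
    (hw.aestronglyMeasurable.smul
      ((innerSL ℝ).continuous.comp hρ'_cont).aestronglyMeasurable)
    (.of_forall fun y x _ => by
      rw [norm_smul, innerSL_apply_norm]
      gcongr
      exact hK _ trivial)
    (hw.norm.mul_const K)
    (.of_forall fun y x _ => ((hρ.comp_sub_const y).hasFDerivAt x).mul_const (w y))
  simp_rw [convolution_lsmul_swap]
  refine hderiv.congr_fderiv ?_
  have hint' : Integrable (fun y => w y • ρ' (mk x - y)) volume :=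
    integrable_smul_of_continuous hw hρ'_cont
  rw [← ContinuousLinearMap.integral_comp_comm _ hint']
  simp

theorem IsWeakGradient.integral_smul_deriv {w : Torus n → ℝ}
    {G : Torus n → EuclideanSpace ℝ (Fin n)} (h : IsWeakGradient w G) (hw : Integrable w volume)
    (hG : Integrable G volume) {ρ : Torus n → ℝ}
    {ρ' : Torus n → EuclideanSpace ℝ (Fin n)} (hρ : HasC1Deriv ρ ρ') (hρ_smooth : IsSmooth ρ)
    (t : Torus n) : ∫ y, w y • ρ' (t - y) = (ρ ⋆ G) t := by
  obtain ⟨x, rfl⟩ := surjective_mk t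
  have proj_integral {f : Torus n → EuclideanSpace ℝ (Fin n)} (hf : Integrable f volume)
      (i : Fin n) : (∫ y, f y) i = ∫ y, f y i :=
    ((EuclideanSpace.proj i : EuclideanSpace ℝ (Fin n) →L[ℝ] ℝ).integral_comp_comm hf).symm
  have hρ_sub_smooth : IsSmooth fun y => ρ (mk x - y) := by
    simp_rw [IsSmooth, ← mk_sub]
    have hlift : ContDiff ℝ ∞ fun x => ρ (mk x) := hρ_smooth
    exact hlift.comp (contDiff_const.sub contDiff_id)
  have hwρ' : Integrable (fun y => w y • ρ' (mk x - y)) volume :=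
    integrable_smul_of_continuous hw (hρ.continuous_deriv.comp (continuous_sub_left (mk x)))
  rw [convolution_lsmul_swap]
  ext i
  rw [proj_integral hwρ', proj_integral (integrable_kernel_smul hρ.continuous hG (mk x))]
  have hparts := h _ hρ_sub_smooth i
  simp only [(hρ.comp_const_sub (mk x)).partialDeriv_eq, PiLp.neg_apply, mul_neg, integral_neg,
    neg_inj] at hparts
  simpa [mul_comm] using hparts

theorem IsWeakGradient.hasC1Deriv_convolution {w : Torus n → ℝ}
    {G : Torus n → EuclideanSpace ℝ (Fin n)} (h : IsWeakGradient w G) (hw : Integrable w volume)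
    (hG : Integrable G volume) {ρ : Torus n → ℝ} (hρ : IsSmooth ρ) :
    HasC1Deriv (ρ ⋆ w) (ρ ⋆ G) where
  continuous_deriv := continuous_convolution hρ.continuous hG
  hasFDerivAt x := by
    obtain ⟨ρ', hρ'⟩ := hρ.exists_hasC1Deriv
    rw [← h.integral_smul_deriv hw hG hρ' hρ]
    exact hρ'.hasFDerivAt_convolution hw x

theorem MemSobolev.exists_tendsto_hasC1Deriv {p : ℝ≥0} (hp : 1 ≤ p) {w : Torus n → ℝ}
    {G : Torus n → EuclideanSpace ℝ (Fin n)} (h : MemSobolev p w G) :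
    ∃ (f : ℕ → Torus n → ℝ) (f' : ℕ → Torus n → EuclideanSpace ℝ (Fin n)),
      (∀ m, HasC1Deriv (f m) (f' m)) ∧
      (∀ᵐ t, Tendsto (fun m => f m t) atTop (𝓝 (w t))) ∧
      Tendsto (fun m => eLpNorm (f m - w) p volume) atTop (𝓝 0) ∧
      Tendsto (fun m => eLpNorm (f' m - G) p volume) atTop (𝓝 0) := by
  have hp' : (1 : ℝ≥0∞) ≤ p := by exact_mod_cast hp
  have hradius : Tendsto (fun m : ℕ => 1 / ((m : ℝ) + 1)) atTop (𝓝[>] 0) :=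
    tendsto_nhdsWithin_iff.2 ⟨tendsto_one_div_add_atTop_nhds_zero_nat,
      .of_forall fun m => Set.mem_Ioi.2 Nat.one_div_pos_of_nat⟩
  have hC1 (r : ℝ) : HasC1Deriv (mollifier r ⋆ w) (mollifier r ⋆ G) :=
    h.isWeakGradient.hasC1Deriv_convolution (h.memLp.integrable hp') (h.memLp_grad.integrable hp')
      (isSmooth_mollifier r)
  have hlim := (tendsto_eLpNorm_mollifier_convolution_sub hp h.memLp).comp hradius
  have hlim' := (tendsto_eLpNorm_mollifier_convolution_sub hp h.memLp_grad).comp hradius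
  obtain ⟨σ, hσ, hae⟩ := (tendstoInMeasure_of_tendsto_eLpNorm (zero_lt_one.trans_le hp').ne'
    (fun m => (hC1 _).continuous.aestronglyMeasurable) h.memLp.aestronglyMeasurable
    hlim).exists_seq_tendsto_ae
  exact ⟨_, _, fun m => hC1 (1 / ((σ m : ℝ) + 1)), hae, hlim.comp hσ.tendsto_atTop,
    hlim'.comp hσ.tendsto_atTop⟩

end Mollification

section SobolevFunctions

theorem MemSobolev.sub {p : ℝ≥0∞} (hp : 1 ≤ p) {u w : Torus n → ℝ}
    {G H : Torus n → EuclideanSpace ℝ (Fin n)} (hu : MemSobolev p u G) (hw : MemSobolev p w H) :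
    MemSobolev p (u - w) (G - H) := by
  refine ⟨hu.memLp.sub hw.memLp, hu.memLp_grad.sub hw.memLp_grad, fun φ hφ i => ?_⟩
  obtain ⟨φ', hφ'⟩ := hφ.exists_hasC1Deriv
  have hpartial : Continuous (partialDeriv i φ) := by
    rw [funext (hφ'.partialDeriv_eq i)]
    exact (EuclideanSpace.proj (𝕜 := ℝ) i).continuous.comp hφ'.continuous_deriv
  have int_grad {G : Torus n → EuclideanSpace ℝ (Fin n)} (hG : MemLp G p volume) :
      Integrable (fun t => G t i • φ t) volume :=
    integrable_smul_of_continuous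
      ((EuclideanSpace.proj (𝕜 := ℝ) i).integrable_comp (hG.integrable hp)) hφ.continuous
  have int_partial {w : Torus n → ℝ} (hw : MemLp w p volume) :
      Integrable (fun t => w t • partialDeriv i φ t) volume :=
    integrable_smul_of_continuous (hw.integrable hp) hpartial
  simp only [smul_eq_mul] at int_grad int_partial
  simp only [Pi.sub_apply, PiLp.sub_apply, sub_mul]
  rw [integral_sub (int_partial hu.memLp) (int_partial hw.memLp),
    integral_sub (int_grad hu.memLp_grad) (int_grad hw.memLp_grad),
    hu.isWeakGradient φ hφ i, hw.isWeakGradient φ hφ i]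
  ring

theorem IsSmooth.mul {φ χ : Torus n → ℝ} (hφ : IsSmooth φ) (hχ : IsSmooth χ) :
    IsSmooth fun t => φ t * χ t :=
  ContDiff.mul hφ hχ

theorem MemSobolev.mul {p : ℝ≥0∞} (hp : 1 ≤ p) {w : Torus n → ℝ}
    {G : Torus n → EuclideanSpace ℝ (Fin n)} (hw : MemSobolev p w G) {φ : Torus n → ℝ}
    {φ' : Torus n → EuclideanSpace ℝ (Fin n)} (hφ : IsSmooth φ) (hφ' : HasC1Deriv φ φ') :
    MemSobolev p (fun t => φ t * w t) (fun t => φ t • G t + w t • φ' t) := by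
  have bdd {F : Type} [NormedAddCommGroup F] {c : Torus n → F} (hc : Continuous c) :
      MemLp c ⊤ volume := hc.memLp_of_hasCompactSupport (.of_compactSpace _)
  refine ⟨hw.memLp.mul (bdd hφ.continuous), (hw.memLp_grad.smul (bdd hφ.continuous)).add
    ((bdd hφ'.continuous_deriv).smul hw.memLp), fun χ hχ i => ?_⟩
  obtain ⟨χ', hχ'⟩ := hχ.exists_hasC1Deriv
  have proj_cont {ψ' : Torus n → EuclideanSpace ℝ (Fin n)} (h : Continuous ψ') :
      Continuous fun t => ψ' t i := (EuclideanSpace.proj (𝕜 := ℝ) i).continuous.comp h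
  have hw_int := hw.memLp.integrable hp
  have hG_int := (EuclideanSpace.proj (𝕜 := ℝ) i).integrable_comp (hw.memLp_grad.integrable hp)
  have int_partial : Integrable (fun t => w t * (φ t * χ' t i)) volume :=
    integrable_smul_of_continuous hw_int (hφ.continuous.mul (proj_cont hχ'.continuous_deriv))
  have int_cross : Integrable (fun t => w t * (χ t * φ' t i)) volume :=
    integrable_smul_of_continuous hw_int (hχ.continuous.mul (proj_cont hφ'.continuous_deriv))
  have int_grad : Integrable (fun t => G t i * (φ t * χ t)) volume :=
    integrable_smul_of_continuous hG_int (hφ.continuous.mul hχ.continuous)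
  have hparts := hw.isWeakGradient _ (hφ.mul hχ) i
  simp only [(hφ'.mul hχ').partialDeriv_eq, hχ'.partialDeriv_eq, PiLp.add_apply, PiLp.smul_apply,
    smul_eq_mul, mul_add] at hparts ⊢
  rw [integral_add int_partial int_cross] at hparts
  calc ∫ t, φ t * w t * χ' t i
      = ∫ t, w t * (φ t * χ' t i) := by congr! 2; ring
    _ = -(∫ t, G t i * (φ t * χ t)) - ∫ t, w t * (χ t * φ' t i) := eq_sub_of_add_eq hparts
    _ = -∫ t, (G t i * (φ t * χ t) + w t * (χ t * φ' t i)) := by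
        rw [integral_add int_grad int_cross, neg_add, sub_eq_add_neg]
    _ = -∫ t, (φ t * G t i + w t * φ' t i) * χ t := by congr! 3; ring

end SobolevFunctions

section AnisotropicSobolev

theorem exists_eLpNorm_comp_mk_restrict_le {S : Set (EuclideanSpace ℝ (Fin n))}
    (hS : Bornology.IsBounded S) (p : ℝ≥0) :
    ∃ m : ℝ≥0, ∀ h : Torus n → ℝ, Continuous h →
      eLpNorm (fun x => h (mk x)) p (volume.restrict S) ≤ m * eLpNorm h p volume := by
  obtain ⟨N, hN⟩ := exists_map_restrict_mk_le hS
  refine ⟨N ^ (p : ℝ)⁻¹, fun h hh => ?_⟩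
  calc eLpNorm (fun x => h (mk x)) p (volume.restrict S)
      = eLpNorm h p (Measure.map mk (volume.restrict S)) :=
        (eLpNorm_map_measure hh.aestronglyMeasurable continuous_mk.aemeasurable).symm
    _ ≤ eLpNorm h p (N • volume) := eLpNorm_mono_measure _ hN
    _ = (N ^ (p : ℝ)⁻¹ : ℝ≥0) * eLpNorm h p volume := by
        rw [eLpNorm_smul_measure_of_ne_top' ENNReal.coe_ne_top]
        simp [ENNReal.smul_def]

/-- A smooth cutoff function on `ℝⁿ`, equal to one on the unit cube. -/
def unitCubeCutoff (n : ℕ) : ContDiffBump (0 : EuclideanSpace ℝ (Fin n)) :=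
  ⟨√n + 1, √n + 2, by positivity, by simp⟩

theorem unitCubeCutoff_eq_one {x : EuclideanSpace ℝ (Fin n)} (hx : x ∈ cube 0) :
    unitCubeCutoff n x = 1 := by
  refine (unitCubeCutoff n).one_of_mem_closedBall ?_
  rw [mem_closedBall_zero_iff, EuclideanSpace.norm_eq]
  calc √(∑ i, ‖x i‖ ^ 2) ≤ √(∑ _i : Fin n, 1 ^ 2) := by
        gcongr with i
        have := hx i
        simp only [Pi.zero_apply, zero_add, Set.mem_Ioc] at this
        rw [Real.norm_of_nonneg this.1.le]
        exact this.2
    _ ≤ √n + 1 := by simp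

theorem eLpNorm_le_eLpNorm_unitCubeCutoff_mul {h : Torus n → ℝ} (hh : Continuous h) (q : ℝ≥0∞) :
    eLpNorm h q volume ≤ eLpNorm (fun x => unitCubeCutoff n x * h (mk x)) q volume := by
  rw [← eLpNorm_comp_measurePreserving hh.aestronglyMeasurable (measurePreserving_mk 0)]
  refine (eLpNorm_congr_ae ?_).trans_le (eLpNorm_restrict_le _ q volume (cube 0))
  have hcube : MeasurableSet (cube (0 : Fin n → ℝ)) := by
    unfold cube; measurability
  filter_upwards [ae_restrict_mem hcube] with x hx
  simp [unitCubeCutoff_eq_one hx]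

theorem HasC1Deriv.hasFDerivAt_cutoff_mul (hf : HasC1Deriv f f') (x : EuclideanSpace ℝ (Fin n)) :
    HasFDerivAt (fun x => unitCubeCutoff n x * f (mk x))
      (unitCubeCutoff n x • innerSL ℝ (f' (mk x)) +
        f (mk x) • fderiv ℝ (unitCubeCutoff n) x) x :=
  ((unitCubeCutoff n).contDiff.differentiable (n := 1) (by simp) x).hasFDerivAt.mul
    (hf.hasFDerivAt x)

theorem exists_eLpNorm_le_of_norm_le_comp_mk {S : Set (EuclideanSpace ℝ (Fin n))}
    (hS : Bornology.IsBounded S) {p : ℝ≥0} (hp : 1 ≤ p) :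
    ∃ m : ℝ≥0, ∀ (K : ℝ≥0) (a b : Torus n → ℝ) (D : EuclideanSpace ℝ (Fin n) → ℝ),
      Continuous a → Continuous b → Function.support D ⊆ S →
      (∀ x, ‖D x‖ ≤ ‖a (mk x)‖ + K * ‖b (mk x)‖) →
      eLpNorm D p volume ≤ m * (eLpNorm a p volume + K * eLpNorm b p volume) := by
  obtain ⟨m, hm⟩ := exists_eLpNorm_comp_mk_restrict_le hS p
  refine ⟨m, fun K a b D ha hb hD hle => ?_⟩
  rw [← eLpNorm_restrict_eq_of_support_subset hD]
  refine (eLpNorm_mono_real hle).trans ((hm (fun t => ‖a t‖ + K * ‖b t‖)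
    (ha.norm.add (continuous_const.mul hb.norm))).trans ?_)
  gcongr
  exact eLpNorm_norm_add_mul_norm_le (by exact_mod_cast hp) ha.aestronglyMeasurable
    hb.aestronglyMeasurable K

theorem exists_eLpNorm_fderiv_cutoff_mul_le {p : ℝ≥0} (hp : 1 ≤ p) {v : EuclideanSpace ℝ (Fin n)}
    (hv : ‖v‖ = 1) :
    ∃ m K : ℝ≥0, ∀ (f : Torus n → ℝ) (f' : Torus n → EuclideanSpace ℝ (Fin n)), HasC1Deriv f f' →
      eLpNorm (fderiv ℝ fun x => unitCubeCutoff n x * f (mk x)) p volume ≤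
          m * (eLpNorm f' p volume + K * eLpNorm f p volume) ∧
        eLpNorm (fun x => fderiv ℝ (fun x => unitCubeCutoff n x * f (mk x)) x v) p volume ≤
          m * (eLpNorm (fun t => inner ℝ (f' t) v) p volume + K * eLpNorm f p volume) := by
  let θ := unitCubeCutoff n
  let S : Set (EuclideanSpace ℝ (Fin n)) := Metric.closedBall 0 (√n + 2)
  obtain ⟨m, hm⟩ := exists_eLpNorm_le_of_norm_le_comp_mk
    (Metric.isBounded_closedBall : Bornology.IsBounded S) hp
  have hθ : ContDiff ℝ 1 θ := θ.contDiff
  obtain ⟨K, hK⟩ := (hθ.continuous_fderiv (by simp)).bounded_above_of_compact_support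
    (θ.hasCompactSupport.fderiv (𝕜 := ℝ))
  lift K to ℝ≥0 using (norm_nonneg _).trans (hK 0)
  refine ⟨m, K, fun f f' hf => ?_⟩
  have hfderiv := fun x => (hf.hasFDerivAt_cutoff_mul x).fderiv
  have hsupp : Function.support (fderiv ℝ fun x => θ x * f (mk x)) ⊆ S :=
    ((support_fderiv_subset ℝ).trans tsupport_mul_subset_left).trans θ.tsupport_eq.subset
  have pointwise {V : Type} [NormedAddCommGroup V] [NormedSpace ℝ V] (x : EuclideanSpace ℝ (Fin n))
      (a d : V) (b : ℝ) (hd : ‖d‖ ≤ K) : ‖θ x • a + b • d‖ ≤ ‖a‖ + K * ‖b‖ := by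
    refine (norm_add_le _ _).trans ?_
    rw [norm_smul, norm_smul, Real.norm_of_nonneg θ.nonneg, mul_comm (K : ℝ)]
    gcongr
    exact mul_le_of_le_one_left (norm_nonneg a) θ.le_one
  constructor
  · rw [← eLpNorm_norm (fderiv ℝ _), ← eLpNorm_norm f']
    refine hm K _ f _ hf.continuous_deriv.norm hf.continuous
      (fun x hx => hsupp (norm_ne_zero_iff.1 hx)) fun x => ?_
    rw [norm_norm, norm_norm, hfderiv, ← innerSL_apply_norm (𝕜 := ℝ) (f' (mk x))]
    exact pointwise x (innerSL ℝ (f' (mk x))) (fderiv ℝ θ x) (f (mk x)) (hK x)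
  · refine hm K _ f _ (hf.continuous_deriv.inner continuous_const) hf.continuous
      (subset_trans (fun x hx => ?_) hsupp) fun x => ?_
    · exact fun h0 => hx (DFunLike.congr_fun h0 v)
    · rw [hfderiv]
      exact pointwise x (inner ℝ (f' (mk x)) v) (fderiv ℝ θ x v) (f (mk x))
        (((fderiv ℝ θ x).le_opNorm v).trans (by simpa [hv] using hK x))

theorem HasC1Deriv.exists_eLpNorm_le_directional {p q : ℝ≥0} (hp : 1 ≤ p) (hn : 0 < n)
    (hpq : (q : ℝ)⁻¹ = (p : ℝ)⁻¹ - (n : ℝ)⁻¹) {v : EuclideanSpace ℝ (Fin n)} (hv : ‖v‖ = 1)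
    {η : ℝ≥0∞} (hη : 0 < η) :
    ∃ C : ℝ≥0, ∀ (f : Torus n → ℝ) (f' : Torus n → EuclideanSpace ℝ (Fin n)), HasC1Deriv f f' →
      eLpNorm f q volume ≤ η * eLpNorm f' p volume +
        C * (eLpNorm (fun t => inner ℝ (f' t) v) p volume + eLpNorm f p volume) := by
  obtain ⟨A, hA⟩ := exists_eLpNorm_le_mul_inv_rpow_mul_eLpNorm_fderiv_add (F := ℝ) (q := q)
    (volume : Measure (EuclideanSpace ℝ (Fin n))) hp (by simpa using hn) (by simpa using hpq) hv
  obtain ⟨m, K, hmK⟩ := exists_eLpNorm_fderiv_cutoff_mul_le hp hv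
  obtain ⟨x, hx, hx_le⟩ := exists_pos_mul_rpow_le (A := A * m) (by finiteness) hη
    (by positivity : (0 : ℝ) < (n : ℝ)⁻¹)
  let l : ℝ≥0 := max 1 x⁻¹
  have hl : A * (l : ℝ≥0∞)⁻¹ ^ (n : ℝ)⁻¹ * m ≤ η := by
    refine le_trans ?_ hx_le
    rw [mul_right_comm]
    gcongr
    rw [ENNReal.inv_le_iff_inv_le, ← ENNReal.coe_inv hx.ne']
    exact_mod_cast le_max_right 1 x⁻¹
  refine ⟨A * m * (K + l + l * K), fun f f' hf => ?_⟩
  have hc : (l : ℝ≥0∞)⁻¹ ^ (n : ℝ)⁻¹ ≤ 1 :=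
    ENNReal.rpow_le_one (ENNReal.inv_le_one.2 (by exact_mod_cast le_max_left 1 x⁻¹))
      (by positivity)
  have hsobolev := hA l (le_max_left 1 x⁻¹) (fun x => unitCubeCutoff n x * f (mk x))
    ((unitCubeCutoff n).contDiff.mul hf.contDiff_lift)
    (unitCubeCutoff n).hasCompactSupport.mul_right
  rw [finrank_euclideanSpace_fin] at hsobolev
  obtain ⟨hgrad, hdir⟩ := hmK f f' hf
  set X := eLpNorm f' p volume
  set Y := eLpNorm (fun t => inner ℝ (f' t) v) p volume
  set Z := eLpNorm f p volume
  set c := (l : ℝ≥0∞)⁻¹ ^ (n : ℝ)⁻¹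
  calc eLpNorm f q volume
      ≤ A * c * (m * (X + K * Z) + l * (m * (Y + K * Z))) :=
        (eLpNorm_le_eLpNorm_unitCubeCutoff_mul hf.continuous q).trans
          (hsobolev.trans (by gcongr))
    _ = A * c * m * X + A * c * m * (l * Y + (K + l * K) * Z) := by ring
    _ ≤ η * X + A * 1 * m * ((K + l + l * K) * Y + (K + l + l * K) * Z) := by
        gcongr
        · exact le_add_right le_add_self
        · exact le_self_add
    _ = η * X + (A * m * (K + l + l * K) : ℝ≥0) * (Y + Z) := by
        push_cast; ring

theorem MemSobolev.exists_eLpNorm_le_directional {p q : ℝ≥0} (hp : 1 ≤ p) (hn : 0 < n)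
    (hpq : (q : ℝ)⁻¹ = (p : ℝ)⁻¹ - (n : ℝ)⁻¹) {v : EuclideanSpace ℝ (Fin n)} (hv : ‖v‖ = 1)
    {η : ℝ≥0} (hη : 0 < η) :
    ∃ C : ℝ≥0, ∀ (w : Torus n → ℝ) (G : Torus n → EuclideanSpace ℝ (Fin n)), MemSobolev p w G →
      eLpNorm w q volume ≤ η * eLpNorm G p volume +
        C * (eLpNorm (fun t => inner ℝ (G t) v) p volume + eLpNorm w p volume) := by
  obtain ⟨C, hC⟩ := HasC1Deriv.exists_eLpNorm_le_directional hp hn hpq hv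
    (ENNReal.coe_pos.2 hη)
  refine ⟨C, fun w G h => ?_⟩
  have hp' : (1 : ℝ≥0∞) ≤ p := by exact_mod_cast hp
  obtain ⟨f, f', hf, hae, hfw, hf'G⟩ := h.exists_tendsto_hasC1Deriv hp
  have hf_meas m : AEStronglyMeasurable (f m) volume := (hf m).continuous.aestronglyMeasurable
  have hf'_meas m : AEStronglyMeasurable (f' m) volume :=
    (hf m).continuous_deriv.aestronglyMeasurable
  have hf'v : Tendsto (fun m => eLpNorm ((fun t => inner ℝ (f' m t) v) - fun t => inner ℝ (G t) v)
      p volume) atTop (𝓝 0) := by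
    refine tendsto_of_tendsto_of_tendsto_of_le_of_le tendsto_const_nhds hf'G (fun _ => zero_le)
      fun m => eLpNorm_mono fun t => ?_
    simpa [hv, ← inner_sub_left] using norm_inner_le_norm (𝕜 := ℝ) (f' m t - G t) v
  have hlim : Tendsto (fun m => η * eLpNorm (f' m) p volume +
      C * (eLpNorm (fun t => inner ℝ (f' m t) v) p volume + eLpNorm (f m) p volume)) atTop
      (𝓝 (η * eLpNorm G p volume +
        C * (eLpNorm (fun t => inner ℝ (G t) v) p volume + eLpNorm w p volume))) := by
    refine .add (ENNReal.Tendsto.const_mul ?_ (.inr ENNReal.coe_ne_top))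
      (ENNReal.Tendsto.const_mul (.add ?_ ?_) (.inr ENNReal.coe_ne_top))
    · exact tendsto_eLpNorm_of_tendsto_eLpNorm_sub hp' hf'_meas h.memLp_grad hf'G
    · exact tendsto_eLpNorm_of_tendsto_eLpNorm_sub hp'
        (fun m => (hf'_meas m).inner aestronglyMeasurable_const) (h.memLp_grad.inner_const v) hf'v
    · exact tendsto_eLpNorm_of_tendsto_eLpNorm_sub hp' hf_meas h.memLp hfw
  calc eLpNorm w q volume ≤ liminf (fun m => eLpNorm (f m) q volume) atTop :=
        Lp.eLpNorm_lim_le_liminf_eLpNorm hf_meas w hae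
    _ ≤ _ := liminf_le_liminf (.of_forall fun m => hC _ _ (hf m))
    _ = _ := hlim.liminf_eq

end AnisotropicSobolev

section RellichKondrachov

open scoped Convolution

theorem HasC1Deriv.sub_eq_integral {f : Torus n → ℝ} {f' : Torus n → EuclideanSpace ℝ (Fin n)}
    (hf : HasC1Deriv f f') (x : Torus n) (h : EuclideanSpace ℝ (Fin n)) :
    f (x - mk h) - f x = ∫ s in Set.Ioc (0 : ℝ) 1, inner ℝ (f' (x - mk (s • h))) (-h) := by
  obtain ⟨x, rfl⟩ := surjective_mk x
  have hcont : Continuous fun s : ℝ => inner ℝ (f' (mk x - mk (s • h))) (-h) :=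
    (hf.continuous_deriv.comp (continuous_const.sub
      (continuous_mk.comp (continuous_id.smul continuous_const)))).inner continuous_const
  have hderiv (s : ℝ) : HasDerivAt (fun s : ℝ => f (mk (x - s • h)))
      (inner ℝ (f' (mk x - mk (s • h))) (-h)) s := by
    have hline : HasDerivAt (fun s : ℝ => x - s • h) (-h) s := by
      simpa using ((hasDerivAt_id s).smul_const h).const_sub x
    have hcomp := (hf.hasFDerivAt (x - s • h)).comp_hasDerivAt s hline
    rw [mk_sub] at hcomp
    exact hcomp
  have hftc := intervalIntegral.integral_eq_sub_of_hasDerivAt (a := 0) (b := 1)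
    (fun s _ => hderiv s) (hcont.intervalIntegrable 0 1)
  rw [intervalIntegral.integral_of_le zero_le_one] at hftc
  rw [hftc]
  simp [mk_sub]

theorem HasC1Deriv.eLpNorm_translate_sub_le {p : ℝ≥0} (hp : 1 ≤ p) {f : Torus n → ℝ}
    {f' : Torus n → EuclideanSpace ℝ (Fin n)} (hf : HasC1Deriv f f') (z : Torus n) :
    eLpNorm (fun x => f (x - z) - f x) p volume ≤
      ENNReal.ofReal (√n * ‖z‖) * eLpNorm f' p volume := by
  obtain ⟨h, rfl, hh⟩ := exists_mk_eq_norm_le z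
  have hcont : Continuous fun a : Torus n × ℝ => inner ℝ (f' (a.1 - mk (a.2 • h))) (-h) :=
    (hf.continuous_deriv.comp (continuous_fst.sub
      (continuous_mk.comp (continuous_snd.smul continuous_const)))).inner continuous_const
  have : IsProbabilityMeasure (volume.restrict (Set.Ioc (0 : ℝ) 1)) := ⟨by simp⟩
  simp_rw [hf.sub_eq_integral]
  refine eLpNorm_integral_le (f := fun x s => inner ℝ (f' (x - mk (s • h))) (-h))
    hcont.aestronglyMeasurable hp (.of_forall fun s => ?_)
  calc eLpNorm (fun x => inner ℝ (f' (x - mk (s • h))) (-h)) p volume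
      ≤ ‖h‖₊ • eLpNorm (fun x => f' (x - mk (s • h))) p volume := by
        refine eLpNorm_le_nnreal_smul_eLpNorm_of_ae_le_mul (.of_forall fun x => ?_) _
        rw [mul_comm]
        simpa using nnnorm_inner_le_nnnorm (𝕜 := ℝ) (f' (x - mk (s • h))) (-h)
    _ = ENNReal.ofReal ‖h‖ * eLpNorm f' p volume := by
        rw [← eLpNorm_comp_measurePreserving hf.continuous_deriv.aestronglyMeasurable
          (measurePreserving_sub_right volume (mk (s • h))), ENNReal.smul_def, smul_eq_mul,
          ofReal_norm, enorm_eq_nnnorm]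
        rfl
    _ ≤ ENNReal.ofReal (√n * ‖mk h‖) * eLpNorm f' p volume := by gcongr

theorem MemSobolev.eLpNorm_translate_sub_le {p : ℝ≥0} (hp : 1 ≤ p) {w : Torus n → ℝ}
    {G : Torus n → EuclideanSpace ℝ (Fin n)} (h : MemSobolev p w G) (z : Torus n) :
    eLpNorm (fun x => w (x - z) - w x) p volume ≤
      ENNReal.ofReal (√n * ‖z‖) * eLpNorm G p volume := by
  have hp' : (1 : ℝ≥0∞) ≤ p := by exact_mod_cast hp
  obtain ⟨f, f', hf, hae, -, hf'⟩ := h.exists_tendsto_hasC1Deriv hp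
  have hlim : ∀ᵐ x, Tendsto (fun m => f m (x - z) - f m x) atTop (𝓝 (w (x - z) - w x)) := by
    filter_upwards [hae, (measurePreserving_sub_right volume z).quasiMeasurePreserving.ae hae]
      with x hx hxz using hxz.sub hx
  have hbound : Tendsto (fun m => ENNReal.ofReal (√n * ‖z‖) * eLpNorm (f' m) p volume) atTop
      (𝓝 (ENNReal.ofReal (√n * ‖z‖) * eLpNorm G p volume)) :=
    ENNReal.Tendsto.const_mul (tendsto_eLpNorm_of_tendsto_eLpNorm_sub hp'
      (fun m => (hf m).continuous_deriv.aestronglyMeasurable) h.memLp_grad hf')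
      (.inr ENNReal.ofReal_ne_top)
  refine (Lp.eLpNorm_lim_le_liminf_eLpNorm (fun m => (Continuous.aestronglyMeasurable ?_)) _
    hlim).trans ((liminf_le_liminf (.of_forall fun m =>
      (hf m).eLpNorm_translate_sub_le hp z)).trans_eq hbound.liminf_eq)
  exact ((hf m).continuous.comp (continuous_sub_right z)).sub (hf m).continuous

theorem dist_convolution_le {ρ : Torus n → ℝ} (hρ : Continuous ρ) {w : Torus n → ℝ}
    (hw : Integrable w volume) {x x' : Torus n} {ε : ℝ}
    (hε : ∀ y, dist (ρ (x - y)) (ρ (x' - y)) ≤ ε) :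
    dist ((ρ ⋆ w) x) ((ρ ⋆ w) x') ≤ ε * ∫ y, ‖w y‖ := by
  have hint := integrable_kernel_smul hρ hw
  rw [dist_eq_norm, convolution_lsmul_swap, convolution_lsmul_swap,
    ← integral_sub (hint x) (hint x'), ← integral_const_mul]
  refine norm_integral_le_of_norm_le (hw.norm.const_mul _) (.of_forall fun y => ?_)
  rw [← sub_smul, norm_smul, ← dist_eq_norm]
  gcongr
  exact hε y

theorem norm_convolution_le {ρ : Torus n → ℝ} {K : ℝ} (hK : ∀ t, ‖ρ t‖ ≤ K) {w : Torus n → ℝ}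
    (hw : Integrable w volume) (x : Torus n) : ‖(ρ ⋆ w) x‖ ≤ K * ∫ y, ‖w y‖ := by
  rw [convolution_lsmul_swap, ← integral_const_mul]
  refine norm_integral_le_of_norm_le (hw.norm.const_mul _) (.of_forall fun y => ?_)
  rw [norm_smul]
  gcongr
  exact hK _

theorem totallyBounded_range_convolution {ι : Type*} {ρ : Torus n → ℝ} (hρ : Continuous ρ)
    {w : ι → Torus n → ℝ} (hw : ∀ i, Integrable (w i) volume) {C : ℝ≥0}
    (hC : ∀ i, ∫ y, ‖w i y‖ ≤ C) :
    TotallyBounded (Set.range fun i =>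
      BoundedContinuousFunction.mkOfCompact ⟨ρ ⋆ w i, continuous_convolution hρ (hw i)⟩) := by
  obtain ⟨K, hK⟩ := isCompact_univ.exists_bound_of_continuousOn hρ.continuousOn
  refine TotallyBounded.subset subset_closure (IsCompact.totallyBounded
    (BoundedContinuousFunction.arzela_ascoli (Metric.closedBall 0 (K * C))
      (isCompact_closedBall _ _) _ ?_ (UniformEquicontinuous.equicontinuous ?_)))
  · rintro _ x ⟨i, rfl⟩
    rw [mem_closedBall_zero_iff]
    have hK0 : 0 ≤ K := (norm_nonneg _).trans (hK 0 trivial)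
    refine (norm_convolution_le (fun t => hK t trivial) (hw i) x).trans ?_
    gcongr
    exact hC i
  · rw [Metric.uniformEquicontinuous_iff]
    intro ε hε
    obtain ⟨δ, hδ, hball⟩ := Metric.uniformContinuous_iff.1
      (CompactSpace.uniformContinuous_of_continuous hρ) (ε / (C + 1)) (by positivity)
    refine ⟨δ, hδ, fun x x' hxx' => ?_⟩
    rintro ⟨_, i, rfl⟩
    calc dist ((ρ ⋆ w i) x) ((ρ ⋆ w i) x')
        ≤ ε / (C + 1) * ∫ y, ‖w i y‖ :=
          dist_convolution_le hρ (hw i) fun y => (hball (by simpa using hxx')).le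
      _ ≤ ε / (C + 1) * C := by gcongr; exact hC i
      _ < ε := by
          rw [div_mul_eq_mul_div, div_lt_iff₀ (by positivity)]
          nlinarith

theorem totallyBounded_range_of_forall_dist_lt {ι α : Type*} [PseudoMetricSpace α] {a : ι → α}
    (h : ∀ ε > 0, ∃ b : ι → α, TotallyBounded (Set.range b) ∧ ∀ i, dist (a i) (b i) < ε) :
    TotallyBounded (Set.range a) := by
  rw [Metric.totallyBounded_iff]
  intro ε hε
  obtain ⟨b, hb, hab⟩ := h (ε / 2) (half_pos hε)
  obtain ⟨s, hs, hcov⟩ := Metric.totallyBounded_iff.1 hb (ε / 2) (half_pos hε)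
  refine ⟨s, hs, ?_⟩
  rintro _ ⟨i, rfl⟩
  obtain ⟨y, hy, hiy⟩ := Set.mem_iUnion₂.1 (hcov ⟨i, rfl⟩)
  refine Set.mem_iUnion₂.2 ⟨y, hy, ?_⟩
  rw [Metric.mem_ball] at hiy ⊢
  linarith [dist_triangle (a i) (b i) y, hab i]

theorem MemSobolev.integral_norm_le {p : ℝ≥0∞} (hp : 1 ≤ p) {w : Torus n → ℝ}
    {G : Torus n → EuclideanSpace ℝ (Fin n)} (hw : MemSobolev p w G) {C : ℝ≥0}
    (hC : sobolevNorm p w G ≤ C) : ∫ y, ‖w y‖ ≤ C := by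
  rw [integral_norm_eq_lintegral_enorm hw.memLp.aestronglyMeasurable,
    ← eLpNorm_one_eq_lintegral_enorm]
  refine ENNReal.toReal_le_coe_of_le_coe ?_
  calc eLpNorm w 1 volume ≤ eLpNorm w p volume :=
        eLpNorm_le_eLpNorm_of_exponent_le hp hw.memLp.aestronglyMeasurable
    _ ≤ sobolevNorm p w G := le_self_add
    _ ≤ C := hC

theorem exists_radius_mul_lt (c : ℝ) {ε : ℝ} (hε : 0 < ε) :
    ∃ r : ℝ, 0 < r ∧ r ≤ 1 / 4 ∧ c * r < ε := by
  have hlim : Tendsto (fun r => c * r) (𝓝[>] 0) (𝓝 0) := by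
    simpa using ((continuous_const_mul c).tendsto 0).mono_left nhdsWithin_le_nhds
  obtain ⟨r, hr, hr'⟩ := ((hlim.eventually_lt_const hε).and
    (Ioc_mem_nhdsGT (by norm_num : (0 : ℝ) < 1 / 4))).exists
  exact ⟨r, hr'.1, hr'.2, hr⟩

theorem totallyBounded_range_toLp_of_memSobolev {ι : Type*} {p : ℝ≥0} [Fact ((1 : ℝ≥0∞) ≤ p)]
    {w : ι → Torus n → ℝ} {G : ι → Torus n → EuclideanSpace ℝ (Fin n)}
    (hw : ∀ i, MemSobolev p (w i) (G i)) {C : ℝ≥0} (hC : ∀ i, sobolevNorm p (w i) (G i) ≤ C) :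
    TotallyBounded (Set.range fun i => (hw i).memLp.toLp) := by
  have hp' : (1 : ℝ≥0∞) ≤ p := Fact.out
  have hp : 1 ≤ p := by exact_mod_cast hp'
  have hint (i : ι) := (hw i).memLp.integrable hp'
  refine totallyBounded_range_of_forall_dist_lt fun ε hε => ?_
  obtain ⟨r, hr, hr', hrε⟩ := exists_radius_mul_lt (√n * 2 * C) hε
  have hcont := (isSmooth_mollifier (n := n) r).continuous
  let b (i : ι) : BoundedContinuousFunction (Torus n) ℝ :=
    .mkOfCompact ⟨mollifier r ⋆ w i, continuous_convolution hcont (hint i)⟩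
  have hb := totallyBounded_range_convolution hcont hint fun i => (hw i).integral_norm_le hp' (hC i)
  have himage := hb.image
    (BoundedContinuousFunction.toLp (E := ℝ) p (volume : Measure (Torus n)) ℝ).uniformContinuous
  rw [← Set.range_comp] at himage
  refine ⟨_, himage, fun i => ?_⟩
  have hdist : dist (BoundedContinuousFunction.toLp p volume ℝ (b i)) (hw i).memLp.toLp =
      (eLpNorm (mollifier r ⋆ w i - w i) p volume).toReal := by
    rw [Lp.dist_def]
    exact congrArg _ (eLpNorm_congr_ae ((BoundedContinuousFunction.coeFn_toLp p volume ℝ (b i)).sub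
      (hw i).memLp.coeFn_toLp))
  rw [dist_comm]
  refine hdist.trans_lt (lt_of_le_of_lt (ENNReal.toReal_le_of_le_ofReal (by positivity) ?_) hrε)
  refine eLpNorm_mollifier_convolution_sub_le hp (hint i) hr hr' fun z hz => ?_
  calc eLpNorm (fun x => w i (x - z) - w i x) p volume
      ≤ ENNReal.ofReal (√n * ‖z‖) * eLpNorm (G i) p volume :=
        (hw i).eLpNorm_translate_sub_le hp z
    _ ≤ ENNReal.ofReal (√n * (2 * r)) * C := by
        gcongr
        exact le_add_self.trans (hC i)
    _ = ENNReal.ofReal (√n * 2 * C * r) := by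
        rw [← ENNReal.ofReal_coe_nnreal, ← ENNReal.ofReal_mul (by positivity)]
        congr 1
        ring

/-- The Rellich–Kondrachov theorem in `L^p`. -/
theorem exists_subseq_tendsto_eLpNorm_sub {p : ℝ≥0} (hp : 1 ≤ p) {w : ℕ → Torus n → ℝ}
    {G : ℕ → Torus n → EuclideanSpace ℝ (Fin n)} (hw : ∀ k, MemSobolev p (w k) (G k)) {C : ℝ≥0}
    (hC : ∀ k, sobolevNorm p (w k) (G k) ≤ C) :
    ∃ (σ : ℕ → ℕ) (U : Torus n → ℝ), StrictMono σ ∧ MemLp U p volume ∧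
      Tendsto (fun j => eLpNorm (w (σ j) - U) p volume) atTop (𝓝 0) := by
  have : Fact ((1 : ℝ≥0∞) ≤ p) := ⟨by exact_mod_cast hp⟩
  obtain ⟨U, -, σ, hσ, hlim⟩ := ((totallyBounded_range_toLp_of_memSobolev hw
    hC).closure.isCompact_of_isClosed isClosed_closure).tendsto_subseq
    fun k => subset_closure (Set.mem_range_self k)
  refine ⟨σ, U, hσ, Lp.memLp U, ?_⟩
  rw [Lp.tendsto_Lp_iff_tendsto_eLpNorm'] at hlim
  exact hlim.congr fun j => eLpNorm_congr_ae ((hw (σ j)).memLp.coeFn_toLp.sub (ae_eq_refl _))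

end RellichKondrachov

section Nonconcentration

theorem eLpNorm_bump_sub_smul_le {r : ℝ} (hr : 0 < r) (hr' : r ≤ 1 / 4) (y : Torus n)
    {F : Type*} [NormedAddCommGroup F] [NormedSpace ℝ F] (h : Torus n → F) (p : ℝ≥0∞) :
    eLpNorm (fun t => bump r (t - y) • h t) p volume ≤
      eLpNorm h p (volume.restrict (Metric.closedBall y (2 * r))) := by
  rw [← eLpNorm_indicator_eq_eLpNorm_restrict Metric.isClosed_closedBall.measurableSet]
  refine eLpNorm_mono fun t => ?_
  by_cases ht : t ∈ Metric.closedBall y (2 * r)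
  · rw [Set.indicator_of_mem ht, norm_smul, Real.norm_of_nonneg (bump_nonneg _ _)]
    exact mul_le_of_le_one_left (norm_nonneg _) (bump_le_one _ _)
  · rw [Metric.mem_closedBall, dist_eq_norm, not_le] at ht
    simp [bump_eq_zero hr hr' ht.le]

theorem eLpNorm_restrict_closedBall_le_eLpNorm_bump_mul {r : ℝ} (hr : 0 < r) (hr' : r ≤ 1 / 4)
    (y : Torus n) (w : Torus n → ℝ) (q : ℝ≥0∞) :
    eLpNorm w q (volume.restrict (Metric.closedBall y r)) ≤
      eLpNorm (fun t => bump r (t - y) * w t) q volume := by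
  rw [← eLpNorm_indicator_eq_eLpNorm_restrict Metric.isClosed_closedBall.measurableSet]
  refine eLpNorm_mono fun t => ?_
  by_cases ht : t ∈ Metric.closedBall y r
  · rw [Set.indicator_of_mem ht, bump_eq_one hr hr' (by simpa [dist_eq_norm] using ht), one_mul]
  · rw [Set.indicator_of_notMem ht, norm_zero]
    exact norm_nonneg _

theorem IsSmooth.comp_sub_const {φ : Torus n → ℝ} (hφ : IsSmooth φ) (y : Torus n) :
    IsSmooth fun t => φ (t - y) := by
  obtain ⟨y, rfl⟩ := surjective_mk y
  simp_rw [IsSmooth, ← mk_sub]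
  have hlift : ContDiff ℝ ∞ fun x => φ (mk x) := hφ
  exact hlift.comp (contDiff_id.sub contDiff_const)

theorem eLpNorm_bump_sub_smul_add_smul_le {p : ℝ≥0∞} (hp : 1 ≤ p) {r : ℝ} (hr : 0 < r)
    (hr' : r ≤ 1 / 4) (y : Torus n) {F : Type*} [NormedAddCommGroup F] [NormedSpace ℝ F]
    {h k : Torus n → F} (hh : AEStronglyMeasurable h volume) (hk : AEStronglyMeasurable k volume)
    {w : Torus n → ℝ} (hw : AEStronglyMeasurable w volume) {D : ℝ≥0} (hD : ∀ t, ‖k t‖ ≤ D) :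
    eLpNorm (fun t => bump r (t - y) • h t + w t • k t) p volume ≤
      eLpNorm h p (volume.restrict (Metric.closedBall y (2 * r))) + D * eLpNorm w p volume := by
  have hbump : AEStronglyMeasurable (fun t => bump r (t - y)) volume :=
    ((isSmooth_bump r).comp_sub_const y).continuous.aestronglyMeasurable
  refine (eLpNorm_add_le (hbump.smul hh) (hw.smul hk) hp).trans
    (add_le_add (eLpNorm_bump_sub_smul_le hr hr' y h p)
      (eLpNorm_le_nnreal_smul_eLpNorm_of_ae_le_mul (.of_forall fun t => ?_) p))
  rw [Pi.smul_apply', nnnorm_smul, mul_comm]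
  gcongr
  exact hD t

theorem MemSobolev.exists_eLpNorm_restrict_closedBall_le {p q : ℝ≥0} (hp : 1 ≤ p) (hn : 0 < n)
    (hpq : (q : ℝ)⁻¹ = (p : ℝ)⁻¹ - (n : ℝ)⁻¹) {v : EuclideanSpace ℝ (Fin n)} (hv : ‖v‖ = 1)
    {η : ℝ≥0} (hη : 0 < η) :
    ∃ C : ℝ≥0, ∀ r : ℝ, 0 < r → r ≤ 1 / 4 → ∃ E : ℝ≥0, ∀ (w : Torus n → ℝ)
      (G : Torus n → EuclideanSpace ℝ (Fin n)), MemSobolev p w G → ∀ y,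
      eLpNorm w q (volume.restrict (Metric.closedBall y r)) ≤
        η * eLpNorm G p (volume.restrict (Metric.closedBall y (2 * r))) +
        C * eLpNorm (fun t => inner ℝ (G t) v) p
          (volume.restrict (Metric.closedBall y (2 * r))) +
        E * eLpNorm w p volume := by
  have hp' : (1 : ℝ≥0∞) ≤ p := by exact_mod_cast hp
  obtain ⟨C, hC⟩ := MemSobolev.exists_eLpNorm_le_directional hp hn hpq hv hη
  refine ⟨C, fun r hr hr' => ?_⟩
  obtain ⟨φ', hφ'⟩ := (isSmooth_bump (n := n) r).exists_hasC1Deriv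
  obtain ⟨D, hD⟩ : ∃ D : ℝ≥0, ∀ t, ‖φ' t‖ ≤ D := by
    obtain ⟨K, hK⟩ := isCompact_univ.exists_bound_of_continuousOn
      hφ'.continuous_deriv.continuousOn
    exact ⟨K.toNNReal, fun t => (hK t trivial).trans K.le_coe_toNNReal⟩
  refine ⟨η * D + C * (D + 1), fun w G hw y => ?_⟩
  have hwm := hw.memLp.aestronglyMeasurable
  have hGm := hw.memLp_grad.aestronglyMeasurable
  have hφ'm : AEStronglyMeasurable (fun t => φ' (t - y)) volume :=
    (hφ'.continuous_deriv.comp (continuous_sub_right y)).aestronglyMeasurable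
  have hval : eLpNorm (fun t => bump r (t - y) * w t) p volume ≤ eLpNorm w p volume :=
    (eLpNorm_bump_sub_smul_le hr hr' y w p).trans (eLpNorm_restrict_le ..)
  have hgrad := eLpNorm_bump_sub_smul_add_smul_le hp' hr hr' y hGm hφ'm hwm fun t => hD (t - y)
  have hdir := eLpNorm_bump_sub_smul_add_smul_le hp' hr hr' y (hGm.inner (𝕜 := ℝ)
    (aestronglyMeasurable_const (b := v))) (hφ'm.inner (𝕜 := ℝ) aestronglyMeasurable_const)
    hwm fun t => (norm_inner_le_norm (φ' (t - y)) v).trans (by simpa [hv] using hD (t - y))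
  simp_rw [smul_eq_mul, ← real_inner_smul_left, ← inner_add_left] at hdir
  calc eLpNorm w q (volume.restrict (Metric.closedBall y r))
      ≤ eLpNorm (fun t => bump r (t - y) * w t) q volume :=
        eLpNorm_restrict_closedBall_le_eLpNorm_bump_mul hr hr' y w q
    _ ≤ _ := hC _ _ (hw.mul hp' ((isSmooth_bump r).comp_sub_const y) (hφ'.comp_sub_const y))
    _ ≤ _ := add_le_add (mul_le_mul_right hgrad _) (mul_le_mul_right (add_le_add hdir hval) _)
    _ = _ := by
        push_cast
        ring

/-- The functions `h i` do not concentrate in `L^p` at points: along `l`, their norms on balls of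
radius `r` are uniformly small as `r → 0`. The filter `l` is general so that differences
`h i - h j` can be treated along `l ×ˢ l`. -/
def NonConcentrating {ι : Type*} (p : ℝ≥0∞) (l : Filter ι) (h : ι → Torus n → ℝ) : Prop :=
  ∀ a : ℝ≥0, 0 < a → ∃ r > 0, ∀ᶠ i in l, ∀ y,
    eLpNorm (h i) p (volume.restrict (Metric.closedBall y r)) ≤ a

theorem NonConcentrating.comp_tendsto {ι κ : Type*} {p : ℝ≥0∞} {l : Filter ι} {l' : Filter κ}
    {h : ι → Torus n → ℝ} (hh : NonConcentrating p l h) {σ : κ → ι} (hσ : Tendsto σ l' l) :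
    NonConcentrating p l' fun j => h (σ j) := fun a ha =>
  let ⟨r, hr, hsmall⟩ := hh a ha
  ⟨r, hr, hσ.eventually hsmall⟩

theorem NonConcentrating.sub {ι : Type*} {p : ℝ≥0∞} (hp : 1 ≤ p) {l : Filter ι}
    {h : ι → Torus n → ℝ} (hh : NonConcentrating p l h)
    (hm : ∀ i, AEStronglyMeasurable (h i) volume) :
    NonConcentrating p (l ×ˢ l) fun i : ι × ι => h i.1 - h i.2 := by
  intro a ha
  obtain ⟨r, hr, hsmall⟩ := hh (a / 2) (half_pos ha)
  refine ⟨r, hr, (hsmall.prod_mk hsmall).mono fun i hi y => ?_⟩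
  calc eLpNorm (h i.1 - h i.2) p (volume.restrict (Metric.closedBall y r))
      ≤ _ := eLpNorm_sub_le (hm i.1).restrict (hm i.2).restrict hp
    _ ≤ (a / 2 : ℝ≥0) + (a / 2 : ℝ≥0) := add_le_add (hi.1 y) (hi.2 y)
    _ = a := by rw [← ENNReal.coe_add, add_halves]

theorem lt_of_inv_eq_inv_sub_inv {p q : ℝ≥0} (hn : 0 < n) (hq : 0 < q)
    (hpq : (q : ℝ)⁻¹ = (p : ℝ)⁻¹ - (n : ℝ)⁻¹) : p < q := by
  have hn' : (0 : ℝ) < (n : ℝ)⁻¹ := by positivity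
  have hq' : (0 : ℝ) < (q : ℝ)⁻¹ := by positivity
  have hinv : (q : ℝ)⁻¹ < (p : ℝ)⁻¹ := by linarith
  exact_mod_cast (inv_lt_inv₀ (inv_pos.1 hq') (inv_pos.1 (hq'.trans hinv))).1 hinv

theorem MemSobolev.memLp_sobolev {p q : ℝ≥0} (hp : 1 ≤ p) (hn : 0 < n)
    (hpq : (q : ℝ)⁻¹ = (p : ℝ)⁻¹ - (n : ℝ)⁻¹) {w : Torus n → ℝ}
    {G : Torus n → EuclideanSpace ℝ (Fin n)} (hw : MemSobolev p w G) : MemLp w q volume := by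
  let v : EuclideanSpace ℝ (Fin n) := EuclideanSpace.single ⟨0, hn⟩ 1
  obtain ⟨C, hC⟩ := MemSobolev.exists_eLpNorm_le_directional hp hn hpq (v := v) (by simp [v])
    one_pos
  refine ⟨hw.memLp.aestronglyMeasurable, (hC w G hw).trans_lt ?_⟩
  have hG := hw.memLp_grad.eLpNorm_lt_top
  have hGv := (hw.memLp_grad.inner_const (𝕜 := ℝ) v).eLpNorm_lt_top
  have hw' := hw.memLp.eLpNorm_lt_top
  finiteness

theorem volume_closedBall_two_mul (t : Torus n) {r : ℝ} (hr : 0 ≤ r) (hr' : r ≤ 1 / 4) :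
    volume (Metric.closedBall t (2 * r)) = 2 ^ n * volume (Metric.closedBall t r) := by
  rw [volume_closedBall t hr (by linarith), volume_closedBall t (by linarith) (by linarith),
    ENNReal.ofReal_mul zero_le_two, mul_pow, ENNReal.ofReal_ofNat]

theorem MemSobolev.exists_eLpNorm_rpow_le {p q : ℝ≥0} (hp : 1 ≤ p) (hn : 0 < n) (hq : 0 < q)
    (hpq : (q : ℝ)⁻¹ = (p : ℝ)⁻¹ - (n : ℝ)⁻¹) {v : EuclideanSpace ℝ (Fin n)} (hv : ‖v‖ = 1)
    {η : ℝ≥0} (hη : 0 < η) :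
    ∃ C : ℝ≥0, ∀ r : ℝ, 0 < r → r ≤ 1 / 4 → ∃ E : ℝ≥0∞, E ≠ ⊤ ∧ ∀ (w : Torus n → ℝ)
      (G : Torus n → EuclideanSpace ℝ (Fin n)), MemSobolev p w G → ∀ M a : ℝ≥0,
      eLpNorm G p volume ≤ M →
      (∀ y, eLpNorm (fun t => inner ℝ (G t) v) p
        (volume.restrict (Metric.closedBall y (2 * r))) ≤ a) →
      eLpNorm w q volume ^ (q : ℝ) ≤
        3 ^ (q - 1 : ℝ) * 2 ^ n * M ^ (p : ℝ) *
          (M ^ (q - p : ℝ) * η ^ (q : ℝ) + C ^ (q : ℝ) * a ^ (q - p : ℝ)) +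
        E * eLpNorm w p volume ^ (q : ℝ) := by
  obtain ⟨C, hC⟩ := MemSobolev.exists_eLpNorm_restrict_closedBall_le hp hn hpq hv hη
  refine ⟨C, fun r hr hr' => ?_⟩
  obtain ⟨E, hE⟩ := hC r hr hr'
  set V := volume (Metric.closedBall (0 : Torus n) r)
  have hV0 : V ≠ 0 := (Metric.measure_closedBall_pos volume 0 hr).ne'
  have hVtop : V ≠ ⊤ := by finiteness
  refine ⟨V⁻¹ * (3 ^ (q - 1 : ℝ) * E ^ (q : ℝ)), by finiteness, fun w G hw M a hM ha => ?_⟩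
  have hpq' : p < q := lt_of_inv_eq_inv_sub_inv hn hq hpq
  set Z := eLpNorm w p volume
  set K : ℝ≥0∞ := M ^ (q - p : ℝ) * η ^ (q : ℝ) + C ^ (q : ℝ) * a ^ (q - p : ℝ)
  set B := fun y : Torus n => (volume : Measure (Torus n)).restrict (Metric.closedBall y (2 * r))
  have hK : K ≠ ⊤ := by
    have hsub : (0 : ℝ) ≤ q - p := sub_nonneg.2 (by exact_mod_cast hpq'.le)
    finiteness
  have hlocal (y : Torus n) : eLpNorm w q (volume.restrict (Metric.closedBall y r)) ^ (q : ℝ) ≤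
      3 ^ (q - 1 : ℝ) * (K * eLpNorm G p (B y) ^ (p : ℝ) + E ^ (q : ℝ) * Z ^ (q : ℝ)) :=
    rpow_le_of_le_mul_add_mul_add (hE w G hw y)
      (eLpNorm_mono fun t => by simpa [hv] using norm_inner_le_norm (𝕜 := ℝ) (G t) v)
      ((eLpNorm_restrict_le ..).trans hM) (ha y) (by exact_mod_cast hp.trans hpq'.le) p.2
      (by exact_mod_cast hpq'.le)
  have hglobal : V * eLpNorm w q volume ^ (q : ℝ) ≤
      3 ^ (q - 1 : ℝ) * (K * (2 ^ n * V * M ^ (p : ℝ)) + E ^ (q : ℝ) * Z ^ (q : ℝ)) := by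
    rw [← lintegral_eLpNorm_restrict_closedBall_rpow hq.ne' (hw.memLp_sobolev hp hn hpq).1]
    refine (lintegral_mono hlocal).trans ?_
    rw [lintegral_const_mul' _ _ (by finiteness), lintegral_add_right _ measurable_const,
      lintegral_const_mul' _ _ (by finiteness), lintegral_const, measure_univ, mul_one,
      lintegral_eLpNorm_restrict_closedBall_rpow (zero_lt_one.trans_le hp).ne'
        hw.memLp_grad.aestronglyMeasurable,
      volume_closedBall_two_mul 0 hr.le hr']
    gcongr
  calc eLpNorm w q volume ^ (q : ℝ) = V⁻¹ * (V * eLpNorm w q volume ^ (q : ℝ)) := by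
        rw [← mul_assoc, ENNReal.inv_mul_cancel hV0 hVtop, one_mul]
    _ ≤ _ := mul_le_mul_right hglobal _
    _ = V⁻¹ * V * (3 ^ (q - 1 : ℝ) * 2 ^ n * M ^ (p : ℝ) * K) +
        V⁻¹ * (3 ^ (q - 1 : ℝ) * E ^ (q : ℝ)) * Z ^ (q : ℝ) := by ring
    _ = _ := by rw [ENNReal.inv_mul_cancel hV0 hVtop, one_mul]

theorem MemSobolev.tendsto_eLpNorm_zero_of_nonConcentrating {ι : Type*} {l : Filter ι} {p q : ℝ≥0}
    (hp : 1 ≤ p) (hn : 0 < n) (hq : 0 < q) (hpq : (q : ℝ)⁻¹ = (p : ℝ)⁻¹ - (n : ℝ)⁻¹)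
    {v : EuclideanSpace ℝ (Fin n)} (hv : ‖v‖ = 1) {w : ι → Torus n → ℝ}
    {G : ι → Torus n → EuclideanSpace ℝ (Fin n)} (hw : ∀ i, MemSobolev p (w i) (G i)) {M : ℝ≥0}
    (hM : ∀ i, eLpNorm (G i) p volume ≤ M)
    (hG : NonConcentrating p l fun i t => inner ℝ (G i t) v)
    (hlim : Tendsto (fun i => eLpNorm (w i) p volume) l (𝓝 0)) :
    Tendsto (fun i => eLpNorm (w i) q volume) l (𝓝 0) := by
  have hpq' : (0 : ℝ) < q - p := sub_pos.2 (lt_of_inv_eq_inv_sub_inv hn hq hpq)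
  have hq' : (0 : ℝ) < q := hq
  suffices h : Tendsto (fun i => eLpNorm (w i) q volume ^ (q : ℝ)) l (𝓝 0) by
    simpa [ENNReal.rpow_rpow_inv hq'.ne', ENNReal.zero_rpow_of_pos (inv_pos.2 hq')]
      using h.ennrpow_const (q : ℝ)⁻¹
  refine ENNReal.tendsto_nhds_zero.2 fun ε hε => ?_
  have hε3 : 0 < ε / 3 := ENNReal.div_pos hε.ne' (by simp)
  set A : ℝ≥0∞ := 3 ^ (q - 1 : ℝ) * 2 ^ n * M ^ (p : ℝ)
  have hA : A ≠ ⊤ := by finiteness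
  obtain ⟨η, hη, hηε⟩ := exists_pos_mul_rpow_le (A := A * M ^ (q - p : ℝ)) (by finiteness) hε3 hq'
  obtain ⟨C, hC⟩ := MemSobolev.exists_eLpNorm_rpow_le hp hn hq hpq hv hη
  obtain ⟨a, ha, haε⟩ := exists_pos_mul_rpow_le (A := A * C ^ (q : ℝ)) (by finiteness) hε3 hpq'
  obtain ⟨R, hR, hsmall⟩ := hG a ha
  obtain ⟨E, hE, hbound⟩ := hC (min (R / 2) (1 / 4)) (by positivity) (min_le_right _ _)
  have hElim : Tendsto (fun i => E * eLpNorm (w i) p volume ^ (q : ℝ)) l (𝓝 0) := by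
    simpa [ENNReal.zero_rpow_of_pos hq'] using
      ENNReal.Tendsto.const_mul (hlim.ennrpow_const (q : ℝ)) (.inr hE)
  filter_upwards [hsmall, hElim.eventually_le_const hε3] with i hi hEi
  have hball (y : Torus n) : Metric.closedBall y (2 * min (R / 2) (1 / 4)) ⊆
      Metric.closedBall y R :=
    Metric.closedBall_subset_closedBall (by linarith [min_le_left (R / 2) (1 / 4 : ℝ)])
  calc eLpNorm (w i) q volume ^ (q : ℝ)
      ≤ A * (M ^ (q - p : ℝ) * η ^ (q : ℝ) + C ^ (q : ℝ) * a ^ (q - p : ℝ)) +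
        E * eLpNorm (w i) p volume ^ (q : ℝ) :=
        hbound _ _ (hw i) M a (hM i) fun y =>
          (eLpNorm_mono_measure _ (Measure.restrict_mono (hball y) le_rfl)).trans (hi y)
    _ = A * M ^ (q - p : ℝ) * η ^ (q : ℝ) + A * C ^ (q : ℝ) * a ^ (q - p : ℝ) +
        E * eLpNorm (w i) p volume ^ (q : ℝ) := by ring
    _ ≤ ε / 3 + ε / 3 + ε / 3 := by gcongr
    _ = ε := ENNReal.add_thirds ε

theorem exists_subseq_tendsto_eLpNorm_sub_of_nonConcentrating {p q : ℝ≥0} (hp : 1 ≤ p)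
    (hn : 0 < n) (hq : 0 < q) (hpq : (q : ℝ)⁻¹ = (p : ℝ)⁻¹ - (n : ℝ)⁻¹)
    {v : EuclideanSpace ℝ (Fin n)} (hv : ‖v‖ = 1) {w : ℕ → Torus n → ℝ}
    {G : ℕ → Torus n → EuclideanSpace ℝ (Fin n)} (hw : ∀ k, MemSobolev p (w k) (G k)) {C : ℝ≥0}
    (hC : ∀ k, sobolevNorm p (w k) (G k) ≤ C)
    (hG : NonConcentrating p atTop fun k t => inner ℝ (G k t) v) :
    ∃ (σ : ℕ → ℕ) (U : Torus n → ℝ), StrictMono σ ∧ MemLp U q volume ∧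
      Tendsto (fun j => eLpNorm (w (σ j) - U) q volume) atTop (𝓝 0) := by
  have hp' : (1 : ℝ≥0∞) ≤ p := by exact_mod_cast hp
  have hq' : (1 : ℝ≥0∞) ≤ q := by
    exact_mod_cast hp.trans (lt_of_inv_eq_inv_sub_inv hn hq hpq).le
  have hwm k := (hw k).memLp.aestronglyMeasurable
  obtain ⟨σ, U₀, hσ, hU₀, hlim⟩ := exists_subseq_tendsto_eLpNorm_sub hp hw hC
  have hcauchy : Tendsto (fun m : ℕ × ℕ => eLpNorm (w (σ m.1) - w (σ m.2)) p volume)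
      (atTop ×ˢ atTop) (𝓝 0) := by
    refine tendsto_of_tendsto_of_tendsto_of_le_of_le tendsto_const_nhds
      (by simpa using (hlim.comp tendsto_fst).add (hlim.comp tendsto_snd)) (fun _ => zero_le)
      fun m => ?_
    simpa using eLpNorm_sub_le (μ := volume) ((hwm (σ m.1)).sub hU₀.aestronglyMeasurable)
      ((hwm (σ m.2)).sub hU₀.aestronglyMeasurable) hp'
  have hGsub : NonConcentrating p (atTop ×ˢ atTop) fun (m : ℕ × ℕ) t =>
      inner ℝ ((G (σ m.1) - G (σ m.2)) t) v := by
    simp_rw [Pi.sub_apply, inner_sub_left]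
    exact (hG.comp_tendsto hσ.tendsto_atTop).sub hp' fun k =>
      (hw (σ k)).memLp_grad.aestronglyMeasurable.inner aestronglyMeasurable_const
  have hbound (m : ℕ × ℕ) : eLpNorm (G (σ m.1) - G (σ m.2)) p volume ≤ (2 * C : ℝ≥0) := by
    have hGC k : eLpNorm (G k) p volume ≤ C := le_add_self.trans (hC k)
    calc eLpNorm (G (σ m.1) - G (σ m.2)) p volume
        ≤ _ := eLpNorm_sub_le (hw _).memLp_grad.1 (hw _).memLp_grad.1 hp'
      _ ≤ C + C := add_le_add (hGC _) (hGC _)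
      _ = _ := by rw [two_mul, ENNReal.coe_add]
  obtain ⟨U, hU, hUlim⟩ := exists_tendsto_eLpNorm_sub_of_cauchy hq'
    (fun k => (hw (σ k)).memLp_sobolev hp hn hpq)
    (MemSobolev.tendsto_eLpNorm_zero_of_nonConcentrating hp hn hq hpq hv
      (fun m => .sub hp' (hw (σ m.1)) (hw (σ m.2))) hbound hGsub hcauchy)
  exact ⟨σ, U, hσ, hU, hUlim⟩

end Nonconcentration

section WeakStar

theorem density_abs_rpow_apply {s : ℝ≥0} (hs : s ≠ 0) (h : Torus n → ℝ) {A : Set (Torus n)}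
    (hA : MeasurableSet A) :
    density (fun x => |h x| ^ (s : ℝ)) A = eLpNorm h s (volume.restrict A) ^ (s : ℝ) := by
  rw [density, withDensity_apply _ hA, eLpNorm_nnreal_pow_eq_lintegral hs]
  refine lintegral_congr fun x => ?_
  rw [Real.enorm_eq_ofReal_abs, ENNReal.ofReal_rpow_of_nonneg (abs_nonneg _) s.coe_nonneg]

theorem isFiniteMeasure_density_abs_rpow {s : ℝ≥0} (hs : s ≠ 0) {h : Torus n → ℝ}
    (hh : MemLp h s volume) : IsFiniteMeasure (density fun x => |h x| ^ (s : ℝ)) := by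
  refine ⟨?_⟩
  rw [density_abs_rpow_apply hs h .univ, Measure.restrict_univ]
  exact ENNReal.rpow_lt_top_of_nonneg s.coe_nonneg hh.eLpNorm_lt_top.ne

theorem WeakStarTendsto.tendsto_finiteMeasure {ν : ℕ → Measure (Torus n)} {μ : Measure (Torus n)}
    [∀ k, IsFiniteMeasure (ν k)] [IsFiniteMeasure μ] (h : WeakStarTendsto ν μ) :
    Tendsto (β := FiniteMeasure (Torus n)) (fun k => ⟨ν k, inferInstance⟩) atTop
      (𝓝 ⟨μ, inferInstance⟩) :=
  FiniteMeasure.tendsto_iff_forall_integral_tendsto.2 fun φ => h φ.toContinuousMap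

theorem WeakStarTendsto.limsup_measure_closed_le {ν : ℕ → Measure (Torus n)}
    {μ : Measure (Torus n)} [∀ k, IsFiniteMeasure (ν k)] [IsFiniteMeasure μ]
    (h : WeakStarTendsto ν μ) {F : Set (Torus n)} (hF : IsClosed F) :
    limsup (fun k => ν k F) atTop ≤ μ F :=
  FiniteMeasure.limsup_measure_closed_le_of_tendsto h.tendsto_finiteMeasure hF

theorem WeakStarTendsto.tendsto_measure_univ {ν : ℕ → Measure (Torus n)} {μ : Measure (Torus n)}
    [∀ k, IsFiniteMeasure (ν k)] [IsFiniteMeasure μ] (h : WeakStarTendsto ν μ) :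
    Tendsto (fun k => ν k Set.univ) atTop (𝓝 (μ Set.univ)) :=
  (ENNReal.tendsto_toNNReal_iff (measure_ne_top μ _) fun k => measure_ne_top (ν k) _).1
    h.tendsto_finiteMeasure.mass

theorem WeakStarTendsto.comp_tendsto {ν : ℕ → Measure (Torus n)} {μ : Measure (Torus n)}
    (h : WeakStarTendsto ν μ) {σ : ℕ → ℕ} (hσ : Tendsto σ atTop atTop) :
    WeakStarTendsto (fun j => ν (σ j)) μ :=
  fun φ => (h φ).comp hσ

theorem IsDiffuse.exists_measure_closedBall_lt {γ : Measure (Torus n)} [IsFiniteMeasure γ]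
    (hγ : IsDiffuse γ) (x : Torus n) {e : ℝ≥0∞} (he : 0 < e) :
    ∃ s > 0, γ (Metric.closedBall x s) < e := by
  obtain ⟨U, hxU, hU, hUe⟩ := Set.exists_isOpen_lt_of_lt {x} e ((hγ x).trans_lt he)
  obtain ⟨s, hs, hsU⟩ := Metric.nhds_basis_closedBall.mem_iff.1
    (hU.mem_nhds (Set.singleton_subset_iff.1 hxU))
  exact ⟨s, hs, (measure_mono hsU).trans_lt hUe⟩

theorem WeakStarTendsto.exists_measure_closedBall_le {ν : ℕ → Measure (Torus n)}
    {γ : Measure (Torus n)} [∀ k, IsFiniteMeasure (ν k)] [IsFiniteMeasure γ]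
    (h : WeakStarTendsto ν γ) (hγ : IsDiffuse γ) {e : ℝ≥0∞} (he : 0 < e) :
    ∃ r > 0, ∀ᶠ k in atTop, ∀ y, ν k (Metric.closedBall y r) ≤ e := by
  suffices hcompact : ∃ r > 0, ∀ᶠ k in atTop, ∀ y ∈ (Set.univ : Set (Torus n)),
      ν k (Metric.closedBall y r) ≤ e by simpa using hcompact
  refine isCompact_univ.induction_on (p := fun S => ∃ r > 0, ∀ᶠ k in atTop, ∀ y ∈ S,
    ν k (Metric.closedBall y r) ≤ e) ⟨1, one_pos, by simp⟩ ?mono ?union fun x _ => ?nhds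
  case mono =>
    rintro S T hST ⟨r, hr, hT⟩
    exact ⟨r, hr, hT.mono fun k hk y hy => hk y (hST hy)⟩
  case union =>
    rintro S T ⟨r, hr, hS⟩ ⟨s, hs, hT⟩
    refine ⟨min r s, lt_min hr hs, ?_⟩
    filter_upwards [hS, hT] with k hkS hkT y hy
    rcases hy with hy | hy
    · exact (measure_mono (Metric.closedBall_subset_closedBall (min_le_left r s))).trans (hkS y hy)
    · exact (measure_mono (Metric.closedBall_subset_closedBall (min_le_right r s))).trans (hkT y hy)
  case nhds =>
    obtain ⟨s, hs, hse⟩ := hγ.exists_measure_closedBall_lt x he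
    refine ⟨Metric.ball x (s / 2),
      mem_nhdsWithin_of_mem_nhds (Metric.ball_mem_nhds x (by linarith)), s / 2, half_pos hs, ?_⟩
    filter_upwards [eventually_lt_of_limsup_lt
      ((h.limsup_measure_closed_le Metric.isClosed_closedBall).trans_lt hse)] with k hk y hy
    exact (measure_mono (Metric.closedBall_subset_closedBall'
      (by linarith [Metric.mem_ball.1 hy]))).trans hk.le

theorem IsDiffuse.nonConcentrating {γ : Measure (Torus n)} [IsFiniteMeasure γ] (hγ : IsDiffuse γ)
    {p : ℝ≥0} (hp : 0 < p) {h : ℕ → Torus n → ℝ} (hh : ∀ j, MemLp (h j) p volume)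
    (hconv : WeakStarTendsto (fun j => density fun x => |h j x| ^ (p : ℝ)) γ) :
    NonConcentrating p atTop h := by
  intro a ha
  have hfin j := isFiniteMeasure_density_abs_rpow hp.ne' (hh j)
  obtain ⟨r, hr, hsmall⟩ := hconv.exists_measure_closedBall_le hγ
    (ENNReal.rpow_pos (p := (p : ℝ)) (ENNReal.coe_pos.2 ha) ENNReal.coe_ne_top)
  refine ⟨r, hr, hsmall.mono fun j hj y => (ENNReal.rpow_le_rpow_iff (z := p) hp).1 ?_⟩
  rw [← density_abs_rpow_apply hp.ne' _ Metric.isClosed_closedBall.measurableSet]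
  exact hj y

theorem tendsto_density_abs_rpow {q : ℝ≥0} (hq : 1 ≤ q) {f : ℕ → Torus n → ℝ} {U : Torus n → ℝ}
    (hf : ∀ j, AEStronglyMeasurable (f j) volume) (hU : MemLp U q volume)
    (hlim : Tendsto (fun j => eLpNorm (f j - U) q volume) atTop (𝓝 0)) {A : Set (Torus n)}
    (hA : MeasurableSet A) :
    Tendsto (fun j => density (fun x => |f j x| ^ (q : ℝ)) A) atTop
      (𝓝 (density (fun x => |U x| ^ (q : ℝ)) A)) := by
  simp_rw [density_abs_rpow_apply (zero_lt_one.trans_le hq).ne' _ hA]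
  refine (tendsto_eLpNorm_of_tendsto_eLpNorm_sub (by exact_mod_cast hq) (fun j => (hf j).restrict)
    (hU.restrict A) ?_).ennrpow_const _
  exact tendsto_of_tendsto_of_tendsto_of_le_of_le tendsto_const_nhds hlim (fun _ => zero_le)
    fun j => eLpNorm_restrict_le ..

theorem WeakStarTendsto.eq_density_abs_rpow {q : ℝ≥0} (hq : 1 ≤ q) {f : ℕ → Torus n → ℝ}
    {U : Torus n → ℝ} (hf : ∀ j, MemLp (f j) q volume) (hU : MemLp U q volume)
    (hlim : Tendsto (fun j => eLpNorm (f j - U) q volume) atTop (𝓝 0)) {μ : Measure (Torus n)}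
    [IsFiniteMeasure μ] (h : WeakStarTendsto (fun j => density fun x => |f j x| ^ (q : ℝ)) μ) :
    μ = density fun x => |U x| ^ (q : ℝ) := by
  have hq0 : q ≠ 0 := (zero_lt_one.trans_le hq).ne'
  have hfin j := isFiniteMeasure_density_abs_rpow hq0 (hf j)
  have hUfin := isFiniteMeasure_density_abs_rpow hq0 hU
  have hset {A : Set (Torus n)} (hA : MeasurableSet A) :=
    tendsto_density_abs_rpow hq (fun j => (hf j).aestronglyMeasurable) hU hlim hA
  refine (Measure.eq_of_le_of_measure_univ_eq (Measure.le_iff.2 fun A hA => ?_)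
    (tendsto_nhds_unique (hset .univ) h.tendsto_measure_univ)).symm
  rw [hA.measure_eq_iSup_isClosed_of_ne_top (measure_ne_top _ A)]
  refine iSup₂_le fun F hFA => iSup_le fun hF => ?_
  calc _ = _ := (hset hF.measurableSet).limsup_eq.symm
    _ ≤ μ F := h.limsup_measure_closed_le hF
    _ ≤ μ A := measure_mono hFA

theorem WeakStarTendsto.strongLpTendsto {q : ℝ≥0} (hq : 1 ≤ q) {u : ℕ → Torus n → ℝ}
    {U w : Torus n → ℝ} (hu : ∀ k, MemLp (u k) q volume) (hU : MemLp U q volume)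
    (h : WeakStarTendsto (fun k => density fun x => |u k x| ^ (q : ℝ))
      (density fun x => |U x| ^ (q : ℝ)))
    {τ : ℕ → ℕ} (hτ : Tendsto τ atTop atTop)
    (hlim : Tendsto (fun j => eLpNorm (u (τ j) - U) q volume) atTop (𝓝 0))
    (hw : StrongLpTendsto 1 u w) : StrongLpTendsto q u w := by
  have hq0 : q ≠ 0 := (zero_lt_one.trans_le hq).ne'
  have hum k := (hu k).aestronglyMeasurable
  have hmeas : TendstoInMeasure volume u atTop w :=
    tendstoInMeasure_of_tendsto_eLpNorm one_ne_zero hum hw.memLp_limit.aestronglyMeasurable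
      hw.tendsto
  have hUw : U =ᵐ[volume] w := tendstoInMeasure_ae_unique
    (tendstoInMeasure_of_tendsto_eLpNorm (by exact_mod_cast hq0) (fun j => hum (τ j))
      hU.aestronglyMeasurable hlim)
    fun ε hε => (hmeas ε hε).comp hτ
  have hwq : MemLp w q volume := hU.ae_eq hUw
  have hfin k := isFiniteMeasure_density_abs_rpow hq0 (hu k)
  have hUfin := isFiniteMeasure_density_abs_rpow hq0 hU
  have hnorm : Tendsto (fun k => eLpNorm (u k) q volume) atTop (𝓝 (eLpNorm w q volume)) := by
    simpa [density_abs_rpow_apply hq0, ENNReal.rpow_rpow_inv, hq0, eLpNorm_congr_ae hUw]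
      using h.tendsto_measure_univ.ennrpow_const (q : ℝ)⁻¹
  exact ⟨hu, hwq, tendsto_eLpNorm_sub_of_tendstoInMeasure hq hum hwq hmeas hnorm⟩

end WeakStar

end Torus

theorem sobolevExponent_pos {n : ℕ} {p : ℝ} (hp : 0 < p) (hpn : p < n) :
    0 < sobolevExponent n p :=
  div_pos (mul_pos (hp.trans hpn) hp) (sub_pos.2 hpn)

theorem inv_sobolevExponent {n : ℕ} {p : ℝ} (hp : 0 < p) (hpn : p < n) :
    (sobolevExponent n p)⁻¹ = p⁻¹ - (n : ℝ)⁻¹ := by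
  have hn : (n : ℝ) ≠ 0 := (hp.trans hpn).ne'
  rw [sobolevExponent]
  field_simp

end

theorem corollary1p5 (n : ℕ) (p : ℝ) (hp : 1 ≤ p) (hpn : p < n)
    (u : ℕ → Torus n → ℝ) (Du : ℕ → Torus n → EuclideanSpace ℝ (Fin n))
    (hu : ∀ k, Torus.MemSobolev (ENNReal.ofReal p) (u k) (Du k))
    (hbdd : ∃ C : ℝ≥0, ∀ k, Torus.sobolevNorm (ENNReal.ofReal p) (u k) (Du k) ≤ C)
    (g : Torus n → ℝ) (hg : Integrable g volume) (hg_nonneg : 0 ≤ᵐ[volume] g)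
    (μs : Measure (Torus n)) [IsFiniteMeasure μs] (hμs : μs ⟂ₘ volume)
    (hconv : Torus.WeakStarTendsto
      (fun k => Torus.density (fun x => |u k x| ^ sobolevExponent n p))
      (Torus.density g + μs))
    (v : EuclideanSpace ℝ (Fin n)) (hv : ‖v‖ = 1)
    (κ : ℕ → ℕ) (hκ : StrictMono κ)
    (γ : Measure (Torus n)) [IsFiniteMeasure γ] (hγ : Torus.IsDiffuse γ)
    (hγconv : Torus.WeakStarTendsto
      (fun j => Torus.density (fun x => |inner ℝ (Du (κ j) x) v| ^ p)) γ) :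
    μs = 0 ∧
      ∀ w : Torus n → ℝ,
        Torus.WeakLpTendsto (ENNReal.ofReal (sobolevExponent n p)) u w →
        Torus.StrongLpTendsto 1 u w →
        Torus.StrongLpTendsto (ENNReal.ofReal (sobolevExponent n p)) u w := by
  have hp0 : 0 < p := zero_lt_one.trans_le hp
  have hn : 0 < n := by exact_mod_cast hp0.trans hpn
  have hq0 := sobolevExponent_pos hp0 hpn
  have hpq := inv_sobolevExponent hp0 hpn
  generalize sobolevExponent n p = q at *
  lift p to ℝ≥0 using hp0.le
  lift q to ℝ≥0 using hq0.le
  simp only [ENNReal.ofReal_coe_nnreal, NNReal.coe_pos, NNReal.one_le_coe] at *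
  have hq : 1 ≤ q := hp.trans (Torus.lt_of_inv_eq_inv_sub_inv hn hq0 hpq).le
  obtain ⟨C, hC⟩ := hbdd
  have huq k : MemLp (u k) q volume := (hu k).memLp_sobolev hp hn hpq
  obtain ⟨σ, U, hσ, hU, hlim⟩ := Torus.exists_subseq_tendsto_eLpNorm_sub_of_nonConcentrating
    hp hn hq0 hpq hv (fun j => hu (κ j)) (fun j => hC (κ j))
    (hγ.nonConcentrating hp0 (fun j => (hu (κ j)).memLp_grad.inner_const v) hγconv)
  have hτ : Tendsto (fun j => κ (σ j)) atTop atTop := hκ.tendsto_atTop.comp hσ.tendsto_atTop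
  have hgfin : IsFiniteMeasure (Torus.density g) := isFiniteMeasure_withDensity_ofReal hg.2
  have hlimit : Torus.density g + μs = Torus.density fun x => |U x| ^ (q : ℝ) :=
    (hconv.comp_tendsto hτ).eq_density_abs_rpow hq (fun j => huq (κ (σ j))) hU hlim
  have hac : μs ≪ volume := (Measure.absolutelyContinuous_of_le
    (Measure.le_add_left le_rfl)).trans (hlimit.absolutelyContinuous.trans
    (withDensity_absolutelyContinuous _ _))
  rw [hlimit] at hconv
  exact ⟨Measure.eq_zero_of_absolutelyContinuous_of_mutuallySingular hac hμs,
    fun w _ hw => hconv.strongLpTendsto hq huq hU hτ hlim hw⟩
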